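/- Let $\Sigma$ be an infinite set of labels with a total order and a minimal element; on the machine below a label is an atom, two labels can be compared, and the minimal label can be produced. A *tree* is a finite rooted unranked unordered tree with nodes labelled in $\Sigma$; its size is its number of nodes. A *Boolean twig query* is a finite rooted tree with node labels in $\Sigma\cup\{\star\}$ and two kinds of edges, child edges ($/$) and descendant edges ($/\!/$); its size is its number of nodes. An *embedding* of a twig query $q$ in a tree $t$ is a map from the nodes of $q$ to the nodes of $t$ that sends root to root, child edges to child edges, descendant edges to pairs (node, proper descendant), and each node with a label $a\ne\star$ to a node labelled $a$. The *language* $\mathcal L_0(q)$ is the set of trees in which $q$ has an embedding; queries with the same language are *equivalent*. A *Boolean path query* is a Boolean twig query in which every node has at most one child. It is *anchored* if every $\star$-node incident to a $/\!/$-edge is the root or the leaf, and, whenever a non-root leaf is labelled $\star$, the edge leading to it is a $/\!/$-edge. $\mathit{AnchPath}_0$ is the class of Boolean anchored path queries. $\mathit{ConjPath}_0$ is the class of finite nonempty sets $P$ of Boolean anchored path queries that are *reduced* (no two different $p,p'\in P$ satisfy $\mathcal L_0(p)\subseteq\mathcal L_0(p')$) and *head-consistent* (all $p\in P$ have the same root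 label); such a $P$ is interpreted as the twig query obtained by gluing the roots of its elements together, which gives its language and its size. Let $\mathcal Q$ be one of these two classes. A *sample* is a finite nonempty set of trees; its size is the sum of the sizes of its elements. A *learning algorithm* takes a sample and returns a query of $\mathcal Q$ or the value Null. Algorithms are programs over binary trees with leaves in $\Sigma\cup\{\mathrm{nil}\}$, built from elementary operations (identity, nil, minimal label, head, tail, comparison of two labels) by pairing, composition, conditionals and while-loops; an elementary operation costs one plus the size of its argument, and every control step costs one. A sample is presented as a list of its elements, without repetitions, in any order and with any order of siblings; a conjunction is returned as a list of its elements. **Theorem.** For each of $\mathcal Q=\mathit{ConjPath}_0$ and $\mathcal Q=\mathit{AnchPath}_0$, the class $\mathcal Q$ is *learnable in polynomial time and data* from positive examples. That is, there are a learning algorithm $\mathsf{learner}$, running in time polynomial in the size of the sample, and a polynomial $\mathit{poly}$ such that: 1. (Soundness) for every sample $S$, $\mathsf{learner}(S)$ is a query $q\in\mathcal Q$ with $S\subseteq\mathcal L_0(q)$, or Null if no such query exists; 2. (Completeness) for every $q\in\mathcal Q$ there is a sample $\mathit{CS}_q\subseteq\mathcal L_0(q)$ of size at most $\mathit{poly}(|q|)$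 such that, for every sample $S$ with $\mathit{CS}_q\subseteq S\subseteq\mathcal L_0(q)$, $\mathsf{learner}(S)$ is a query equivalent to $q$. -/

import Mathlib

universe u

/-! ### Trees, twig queries and embeddings -/

/-- Finite unranked labelled trees, written as terms `a(t₁, …, tₙ)`. The order of the children is an
artefact of the notation and plays no role in the semantics. -/
inductive LTree (α : Type u) : Type u
  | node (label : α) (children : List (LTree α)) : LTree α

/-- The two kinds of edges of a query: `/` and `//`. -/
inductive Edge : Type
  | child
  | desc

/-- Boolean twig queries. A label `none` is the wildcard `⋆`; every child comes with the kind of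
the edge that leads to it. -/
inductive Twig (α : Type u) : Type u
  | node (label : Option α) (children : List (Edge × Twig α)) : Twig α

namespace LTree

variable {α : Type u}

def label : LTree α → α
  | node a _ => a

/-- The subtree at an address; the address `[i₁, …, iₖ]` is the `iₖ`-th child of … of the `i₁`-th
child of the root. -/
def sub : LTree α → List ℕ → Option (LTree α)
  | t, [] => some t
  | node _ ts, i :: p =>
    match ts[i]? with
    | none => none
    | some t => sub t p

/-- The nodes of a tree, identified with their addresses. -/
def Node (t : LTree α) : Type := {p : List ℕ // (t.sub p).isSome}

def root (t : LTree α) : t.Node := ⟨[], by simp [sub]⟩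

def lab (t : LTree α) (n : t.Node) : α := ((t.sub n.1).get n.2).label

/-- `n'` is a child of `n`. -/
def Child (t : LTree α) (n n' : t.Node) : Prop := ∃ i : ℕ, n'.1 = n.1 ++ [i]

/-- `t` and `t'` differ only in the order of siblings, that is, they are the same unordered tree. -/
def Iso (t t' : LTree α) : Prop :=
  ∃ e : t.Node ≃ t'.Node, e t.root = t'.root ∧
    (∀ n n', t.Child n n' ↔ t'.Child (e n) (e n')) ∧ ∀ n, t.lab n = t'.lab (e n)

mutual
/-- The number of nodes of a tree. -/
def size : LTree α → ℕ
  | node _ ts => 1 + sizeList ts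
/-- The number of nodes of a forest. -/
def sizeList : List (LTree α) → ℕ
  | [] => 0
  | t :: ts => size t + sizeList ts
end

end LTree

namespace Twig

variable {α : Type u}

def label : Twig α → Option α
  | node a _ => a

def children : Twig α → List (Edge × Twig α)
  | node _ qs => qs

/-- The subquery at an address. -/
def sub : Twig α → List ℕ → Option (Twig α)
  | q, [] => some q
  | node _ qs, i :: p =>
    match qs[i]? with
    | none => none
    | some eq => sub eq.2 p

/-- The nodes of a query, identified with their addresses. -/
def Node (q : Twig α) : Type := {p : List ℕ // (q.sub p).isSome}

def root (q : Twig α) : q.Node := ⟨[], by simp [sub]⟩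

def lab (q : Twig α) (n : q.Node) : Option α := ((q.sub n.1).get n.2).label

/-- There is an edge of kind `e` from `n` to `n'`. -/
def HasEdge (q : Twig α) (e : Edge) (n n' : q.Node) : Prop :=
  ∃ (i : ℕ) (r : Twig α),
    ((q.sub n.1).get n.2).children[i]? = some (e, r) ∧ n'.1 = n.1 ++ [i]

mutual
/-- The number of nodes of a query. -/
def size : Twig α → ℕ
  | node _ qs => 1 + sizeList qs
/-- The number of nodes of a list of queries. -/
def sizeList : List (Edge × Twig α) → ℕ
  | [] => 0
  | (_, q) :: qs => size q + sizeList qs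
end

/-- Embeddings of the query `q` in the tree `t`. -/
structure IsEmbedding (q : Twig α) (t : LTree α) (f : q.Node → t.Node) : Prop where
  root : f q.root = t.root
  child : ∀ n n', q.HasEdge .child n n' → t.Child (f n) (f n')
  desc : ∀ n n', q.HasEdge .desc n n' → Relation.TransGen t.Child (f n) (f n')
  lab : ∀ n a, q.lab n = some a → t.lab (f n) = a

/-- The language of a Boolean twig query. -/
def lang (q : Twig α) : Set (LTree α) := {t | ∃ f, q.IsEmbedding t f}

end Twig

/-! ### Anchored path queries and their conjunctions -/

/-- Boolean path queries: a root label, followed by the kind of edge and the label for each further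
node, from top to bottom. -/
structure PathQuery (α : Type u) : Type u where
  head : Option α
  steps : List (Edge × Option α)

namespace PathQuery

variable {α : Type u}

/-- What hangs below the root of a path (at most one subquery). -/
def branch : List (Edge × Option α) → List (Edge × Twig α)
  | [] => []
  | (e, a) :: s => [(e, .node a (branch s))]

/-- A path query as a twig query. -/
def toTwig (p : PathQuery α) : Twig α := .node p.head (branch p.steps)

def lang (p : PathQuery α) : Set (LTree α) := p.toTwig.lang

/-- The node at depth `i` exists and is labelled `⋆`. -/
def IsStar (p : PathQuery α) (i : ℕ) : Prop :=
  (p.head :: p.steps.map Prod.snd)[i]? = some none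

/-- The edge from the node at depth `i` to the node at depth `i + 1` exists and is a `//`-edge. -/
def IsDesc (p : PathQuery α) (i : ℕ) : Prop :=
  (p.steps.map Prod.fst)[i]? = some Edge.desc

/-- Boolean anchored path queries: a `⋆`-node incident to a `//`-edge is the root or the leaf, and
the edge that leads to a `⋆`-leaf is a `//`-edge. The leaf has depth `p.steps.length`. -/
structure Anchored (p : PathQuery α) : Prop where
  upper : ∀ i, p.IsDesc i → p.IsStar i → i = 0
  lower : ∀ i, p.IsDesc i → p.IsStar (i + 1) → i + 1 = p.steps.length
  leaf : ∀ i, i + 1 = p.steps.length → p.IsStar (i + 1) → p.IsDesc i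

end PathQuery

/-- The class of Boolean anchored path queries. -/
def AnchPath (α : Type u) : Type u := {p : PathQuery α // p.Anchored}

/-- The class of (nonempty) reduced head-consistent conjunctions of Boolean anchored path queries,
represented as finite sets. -/
structure ConjPath (α : Type u) : Type u where
  paths : Finset (PathQuery α)
  nonempty : paths.Nonempty
  anchored : ∀ p ∈ paths, p.Anchored
  reduced : ∀ p ∈ paths, ∀ p' ∈ paths, p.lang ⊆ p'.lang → p = p'
  headConsistent : ∀ p ∈ paths, ∀ p' ∈ paths, p.head = p'.head

namespace ConjPath

variable {α : Type u}

/-- The twig query obtained from a conjunction by gluing the root nodes together. -/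
noncomputable def toTwig (P : ConjPath α) : Twig α :=
  .node P.nonempty.choose.head (P.paths.toList.flatMap fun p => PathQuery.branch p.steps)

end ConjPath

/-! ### A machine model with labels as atoms -/

/-- The data of the machine: binary trees with leaves `nil` or a label. -/
inductive Data (α : Type u) : Type u
  | nil : Data α
  | atom (a : α) : Data α
  | pair (x y : Data α) : Data α

namespace Data

variable {α : Type u}

def size : Data α → ℕ
  | nil => 1
  | atom _ => 1
  | pair x y => 1 + size x + size y

def ofList : List (Data α) → Data α
  | [] => nil
  | x :: xs => pair x (ofList xs)

end Data

/-- The elementary operations of the machine. -/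
inductive Prim : Type
  | id
  | nil
  | bot
  | head
  | tail
  | le

/-- The values of the elementary operations: `bot` gives the minimal label and `le` compares two
labels; in a test `nil` means false and everything else means true. -/
def Prim.apply {α : Type u} [LinearOrder α] [OrderBot α] : Prim → Data α → Data α
  | .id, x => x
  | .nil, _ => .nil
  | .bot, _ => .atom ⊥
  | .head, .pair x _ => x
  | .head, _ => .nil
  | .tail, .pair _ y => y
  | .tail, _ => .nil
  | .le, .pair (.atom a) (.atom b) => if a ≤ b then .pair .nil .nil else .nil
  | .le, _ => .nil

/-- Programs. Each one transforms a value: `pair f g` runs `f` and `g` on the same input and pairs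
the results, `comp g f` runs `f` and then `g`, `cond t f g` is "if `t` then `f` else `g`", and
`loop t f` is "while `t` do `f`". -/
inductive Prog : Type
  | prim (o : Prim)
  | pair (f g : Prog)
  | comp (g f : Prog)
  | cond (t f g : Prog)
  | loop (t f : Prog)

/-- `c.Runs x y n`: on input `x` the program `c` halts with output `y` after time `n`. An elementary
operation costs one more than the size of its argument (so that copying is not free), and every
control step costs one. -/
inductive Prog.Runs {α : Type u} [LinearOrder α] [OrderBot α] :
    Prog → Data α → Data α → ℕ → Prop
  | prim (o : Prim) (x : Data α) : Runs (.prim o) x (o.apply x) (1 + x.size)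
  | pair {f g : Prog} {x y z : Data α} {m n : ℕ} :
      Runs f x y m → Runs g x z n → Runs (.pair f g) x (.pair y z) (m + n + 1)
  | comp {f g : Prog} {x y z : Data α} {m n : ℕ} :
      Runs f x y m → Runs g y z n → Runs (.comp g f) x z (m + n + 1)
  | cond_true {t f g : Prog} {x b y : Data α} {m n : ℕ} :
      Runs t x b m → b ≠ .nil → Runs f x y n → Runs (.cond t f g) x y (m + n + 1)
  | cond_false {t f g : Prog} {x y : Data α} {m n : ℕ} :
      Runs t x .nil m → Runs g x y n → Runs (.cond t f g) x y (m + n + 1)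
  | loop_stop {t f : Prog} {x : Data α} {m : ℕ} :
      Runs t x .nil m → Runs (.loop t f) x x (m + 1)
  | loop_step {t f : Prog} {x b y z : Data α} {m n k : ℕ} :
      Runs t x b m → b ≠ .nil → Runs f x y n → Runs (.loop t f) y z k →
      Runs (.loop t f) x z (m + n + k + 1)

/-- The machine is deterministic. -/
theorem Prog.Runs.unique {α : Type u} [LinearOrder α] [OrderBot α] {c : Prog} {x y y' : Data α}
    {n n' : ℕ} (h : c.Runs x y n) (h' : c.Runs x y' n') : y = y' ∧ n = n' := by
  induction h generalizing y' n' with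
  | prim o x => cases h'; exact ⟨rfl, rfl⟩
  | pair _ _ ih₁ ih₂ =>
    cases h' with
    | pair a b =>
      obtain ⟨rfl, rfl⟩ := ih₁ a
      obtain ⟨rfl, rfl⟩ := ih₂ b
      exact ⟨rfl, rfl⟩
  | comp _ _ ih₁ ih₂ =>
    cases h' with
    | comp a b =>
      obtain ⟨rfl, rfl⟩ := ih₁ a
      obtain ⟨rfl, rfl⟩ := ih₂ b
      exact ⟨rfl, rfl⟩
  | cond_true _ hb _ ih₁ ih₂ =>
    cases h' with
    | cond_true a _ b =>
      obtain ⟨rfl, rfl⟩ := ih₁ a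
      obtain ⟨rfl, rfl⟩ := ih₂ b
      exact ⟨rfl, rfl⟩
    | cond_false a b => exact absurd (ih₁ a).1 hb
  | cond_false _ _ ih₁ ih₂ =>
    cases h' with
    | cond_true a hb b => exact absurd (ih₁ a).1.symm hb
    | cond_false a b =>
      obtain ⟨_, rfl⟩ := ih₁ a
      obtain ⟨rfl, rfl⟩ := ih₂ b
      exact ⟨rfl, rfl⟩
  | loop_stop _ ih =>
    cases h' with
    | loop_stop a =>
      obtain ⟨_, rfl⟩ := ih a
      exact ⟨rfl, rfl⟩
    | loop_step a hb _ _ => exact absurd (ih a).1.symm hb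
  | loop_step _ hb _ _ ih₁ ih₂ ih₃ =>
    cases h' with
    | loop_stop a => exact absurd (ih₁ a).1 hb
    | loop_step a _ b c =>
      obtain ⟨rfl, rfl⟩ := ih₁ a
      obtain ⟨rfl, rfl⟩ := ih₂ b
      obtain ⟨rfl, rfl⟩ := ih₃ c
      exact ⟨rfl, rfl⟩

/-! ### Representation of trees and queries as data -/

mutual
/-- The tree `a(t₁, …, tₙ)` is represented by the pair of `a` and the list of its subtrees. -/
def LTree.encode {α : Type u} : LTree α → Data α
  | .node a ts => .pair (.atom a) (LTree.encodeList ts)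
def LTree.encodeList {α : Type u} : List (LTree α) → Data α
  | [] => .nil
  | t :: ts => .pair (LTree.encode t) (LTree.encodeList ts)
end

def Edge.encode {α : Type u} : Edge → Data α
  | .child => .nil
  | .desc => .pair .nil .nil

/-- The wildcard is represented by `nil` and a label by itself. -/
def encodeLabel {α : Type u} : Option α → Data α
  | none => .nil
  | some a => .atom a

def PathQuery.encode {α : Type u} (p : PathQuery α) : Data α :=
  .pair (encodeLabel p.head)
    (Data.ofList (p.steps.map fun s => .pair s.1.encode (encodeLabel s.2)))

/-! ### Learnability -/

/-- A learning setting: examples, queries and the semantics `lang`, together with the sizes of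
examples and queries and with their representation as data. An example or a query may have several
representations. -/
structure LearningSetting (α : Type u) where
  Example : Type u
  Query : Type u
  lang : Query → Set Example
  exampleSize : Example → ℕ
  querySize : Query → ℕ
  RepresentsExample : Data α → Example → Prop
  RepresentsQuery : Data α → Query → Prop

namespace LearningSetting

variable {α : Type u} (K : LearningSetting α)

def sampleSize (S : Finset K.Example) : ℕ := ∑ t ∈ S, K.exampleSize t

/-- The query or the value Null that a piece of data represents. -/
def RepresentsResult : Data α → Option K.Query → Prop
  | d, none => d = .nil
  | d, some q => ∃ e, d = .pair .nil e ∧ K.RepresentsQuery e q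

/-- Whenever the sample `S` is presented to `learner` as a list of its elements, in any order, without
repetitions and in any representation of each element, `learner` halts in time at most `T` and
returns a result that satisfies `R`. -/
def Returns [LinearOrder α] [OrderBot α] (learner : Prog) (S : Finset K.Example) (T : ℕ)
    (R : Option K.Query → Prop) : Prop :=
  ∀ l : List K.Example, l.Nodup → (∀ t, t ∈ l ↔ t ∈ S) →
    ∀ ds : List (Data α), List.Forall₂ K.RepresentsExample ds l →
      ∃ (d : Data α) (n : ℕ) (r : Option K.Query),
        learner.Runs (Data.ofList ds) d n ∧ n ≤ T ∧ K.RepresentsResult d r ∧ R r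

/-- The result `r` is sound for the sample `S`: it is a query consistent with `S`, or Null and no
query is consistent with `S`. -/
def SoundResult (S : Finset K.Example) : Option K.Query → Prop
  | some q => (S : Set K.Example) ⊆ K.lang q
  | none => ∀ q : K.Query, ¬ (S : Set K.Example) ⊆ K.lang q

/-- The result is a query equivalent to `q`. -/
def EquivResult (q : K.Query) : Option K.Query → Prop
  | some q' => K.lang q' = K.lang q
  | none => False

/-- Learnability in polynomial time and data. Samples are finite and nonempty. -/
def Learnable [LinearOrder α] [OrderBot α] : Prop :=
  ∃ (learner : Prog) (time poly : Polynomial ℕ),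
    (∀ S : Finset K.Example, S.Nonempty →
      K.Returns learner S (time.eval (K.sampleSize S)) (K.SoundResult S)) ∧
    (∀ q : K.Query, ∃ CS : Finset K.Example, CS.Nonempty ∧
      (CS : Set K.Example) ⊆ K.lang q ∧
      K.sampleSize CS ≤ poly.eval (K.querySize q) ∧
      ∀ S : Finset K.Example, CS ⊆ S → (S : Set K.Example) ⊆ K.lang q →
        K.Returns learner S (time.eval (K.sampleSize S)) (K.EquivResult q))

end LearningSetting

/-- Learning Boolean anchored path queries from positive examples. -/
def anchPathSetting (α : Type u) : LearningSetting α where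
  Example := LTree α
  Query := AnchPath α
  lang p := p.1.lang
  exampleSize t := t.size
  querySize p := p.1.toTwig.size
  RepresentsExample d t := ∃ t' : LTree α, t.Iso t' ∧ d = t'.encode
  RepresentsQuery d p := d = p.1.encode

/-- Learning conjunctions of Boolean anchored path queries from positive examples. A conjunction is
represented by any list of its elements. -/
noncomputable def conjPathSetting (α : Type u) : LearningSetting α where
  Example := LTree α
  Query := ConjPath α
  lang P := P.toTwig.lang
  exampleSize t := t.size
  querySize P := P.toTwig.size
  RepresentsExample d t := ∃ t' : LTree α, t.Iso t' ∧ d = t'.encode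
  RepresentsQuery d P := ∃ l : List (PathQuery α),
    (∀ p, p ∈ l ↔ p ∈ P.paths) ∧ d = Data.ofList (l.map PathQuery.encode)

/-! ### Polynomial-time functions on encoded types -/

-- A path query holds in a tree exactly when its root label fits and it maps homomorphically to the
-- word read on some path from the root (`PathQuery.mem_lang_iff`). Learning thus becomes a question
-- about the order `emb p q` ("`p` maps to `q`", so `p` is more general) on anchored paths. The
-- measure `meas` grows strictly along this order (`emb_meas`), which makes it antisymmetric and
-- bounds chains linearly in the length of the path at the top.
--
-- The key fact is `exists_mem_refinements`: an anchored path strictly more general than an anchored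
-- `q` can be refined by one elementary move to an anchored path that still maps to `q`. Hence
-- refining greedily from the empty path, while staying consistent with the sample, ends in `q`
-- whenever all consistent anchored paths map to `q` and `q` is itself consistent (`greedy_eq`).
--
-- Two trees suffice for a characteristic sample (`exists_characteristic`). Both are made of
-- canonical words of the paths of the query: in one, wildcards become the minimal label and
-- descendant edges are not stretched; in the other, wildcards become a fresh label `c` and
-- descendant edges are stretched by many nodes labelled `c`. An anchored path matching the first
-- tree is short and avoids `c`; if it also matches the second, it maps to a path of the query
-- (`emb_of_emb_canon`). This gives the result for a single path.
--
-- For a conjunction, each path `p` in it is the most specific anchored path matching its own two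
-- canonical words. The learner therefore runs the greedy search for all pairs of words of the
-- sample, with the pair as an extra constraint, and keeps the most specific results. All candidates
-- map to some path of the query and every path of the query is a candidate, so exactly the query
-- remains. Null is never needed: the empty path with a suitable root label fits every sample.
--
-- For the running time, the functions computable in polynomial time (`PT`) are shown to be closed
-- under the usual list operations, provided that intermediate results have polynomial size; `emb`
-- is computed by dynamic programming.

/-- A type whose elements are represented by machine data over the labels `α`. -/
class Enc (α : Type u) (β : Type*) where
  enc : β → Data α

/-- The size of the representation. -/
def sz (α : Type u) {β : Type*} [Enc α β] (b : β) : ℕ := (Enc.enc b : Data α).size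

instance Enc.instUnit {α : Type u} : Enc α Unit := ⟨fun _ => .nil⟩

instance Enc.instBool {α : Type u} : Enc α Bool := ⟨fun b => if b then .pair .nil .nil else .nil⟩

instance Enc.instSelf {α : Type u} : Enc α α := ⟨.atom⟩

instance Enc.instOption {α : Type u} : Enc α (Option α) := ⟨encodeLabel⟩

instance Enc.instEdge {α : Type u} : Enc α Edge := ⟨Edge.encode⟩

instance Enc.instProd {α : Type u} {β γ : Type*} [Enc α β] [Enc α γ] : Enc α (β × γ) :=
  ⟨fun p => .pair (Enc.enc p.1) (Enc.enc p.2)⟩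

instance Enc.instList {α : Type u} {β : Type*} [Enc α β] : Enc α (List β) :=
  ⟨fun l => Data.ofList (l.map Enc.enc)⟩

instance Enc.instLTree {α : Type u} : Enc α (LTree α) := ⟨LTree.encode⟩

-- Sizes of encodings.

section sizes

variable {α : Type u} {β γ : Type*} [Enc α β] [Enc α γ]

theorem sz_pos (b : β) : 1 ≤ sz α b := by
  unfold sz; cases (Enc.enc b : Data α) <;> simp [Data.size]; omega

@[simp] theorem sz_prod (p : β × γ) : sz α p = 1 + sz α p.1 + sz α p.2 := rfl

@[simp] theorem sz_nil : sz α ([] : List β) = 1 := rfl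

@[simp] theorem sz_cons (b : β) (l : List β) : sz α (b :: l) = 1 + sz α b + sz α l := rfl

theorem sz_bool_le (b : Bool) : sz α b ≤ 3 := by cases b <;> simp [sz, Enc.enc, Data.size]

theorem sz_edge_le (e : Edge) : sz α e ≤ 3 := by
  cases e <;> simp [sz, Enc.enc, Edge.encode, Data.size]

@[simp] theorem sz_option (o : Option α) : sz α o = 1 := by cases o <;> rfl

theorem sz_append (l l' : List β) : sz α (l ++ l') + 1 = sz α l + sz α l' := by
  induction l with
  | nil => simp; omega
  | cons x l ih => simp; omega

theorem sz_reverse (l : List β) : sz α l.reverse = sz α l := by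
  induction l with
  | nil => rfl
  | cons x l ih =>
    have := sz_append (α := α) l.reverse [x]
    simp at *; omega

theorem length_lt_sz (l : List β) : l.length < sz α l := by
  induction l with
  | nil => simp
  | cons x l ih => simp; omega

theorem sz_le_of_mem {b : β} {l : List β} (h : b ∈ l) : sz α b ≤ sz α l := by
  induction l with
  | nil => simp at h
  | cons x l ih =>
    rcases List.mem_cons.1 h with rfl | h
    · simp; omega
    · have := ih h; simp; omega

theorem sz_list_le {l : List β} {k : ℕ} (h : ∀ b ∈ l, sz α b ≤ k) :
    sz α l ≤ l.length * (k + 1) + 1 := by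
  induction l with
  | nil => simp
  | cons x l ih =>
    have h₁ := h x (by simp)
    have h₂ := ih fun b hb => h b (by simp [hb])
    simp only [sz_cons, List.length_cons, add_mul, one_mul] at *; omega

end sizes

theorem Polynomial.eval_mono_nat (P : Polynomial ℕ) {m n : ℕ} (h : m ≤ n) :
    P.eval m ≤ P.eval n := by
  rw [Polynomial.eval_eq_sum, Polynomial.eval_eq_sum]
  exact Finset.sum_le_sum fun i _ => Nat.mul_le_mul_left _ (Nat.pow_le_pow_left h i)

/-- `f` is bounded by a polynomial in the size of the representation. -/
def PolyBdd (α : Type u) {β : Type*} [Enc α β] (f : β → ℕ) : Prop :=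
  ∃ P : Polynomial ℕ, ∀ b, f b ≤ P.eval (sz α b)

namespace PolyBdd

variable {α : Type u} {β γ : Type*} [Enc α β] [Enc α γ] {f g : β → ℕ}

theorem const (k : ℕ) : PolyBdd α (fun _ : β => k) := ⟨.C k, by simp⟩

theorem size : PolyBdd α (fun b : β => sz α b) := ⟨.X, by simp⟩

theorem mono (hg : PolyBdd α g) (h : ∀ b, f b ≤ g b) : PolyBdd α f := by
  obtain ⟨P, hP⟩ := hg
  exact ⟨P, fun b => (h b).trans (hP b)⟩

theorem add (hf : PolyBdd α f) (hg : PolyBdd α g) : PolyBdd α fun b => f b + g b := by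
  obtain ⟨P, hP⟩ := hf
  obtain ⟨Q, hQ⟩ := hg
  exact ⟨P + Q, fun b => by simpa using Nat.add_le_add (hP b) (hQ b)⟩

theorem mul (hf : PolyBdd α f) (hg : PolyBdd α g) : PolyBdd α fun b => f b * g b := by
  obtain ⟨P, hP⟩ := hf
  obtain ⟨Q, hQ⟩ := hg
  exact ⟨P * Q, fun b => by simpa using Nat.mul_le_mul (hP b) (hQ b)⟩

theorem eval (P : Polynomial ℕ) (hf : PolyBdd α f) : PolyBdd α fun b => P.eval (f b) := by
  obtain ⟨Q, hQ⟩ := hf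
  exact ⟨P.comp Q, fun b => by simpa using P.eval_mono_nat (hQ b)⟩

end PolyBdd

variable {α : Type u} [LinearOrder α] [OrderBot α]

-- Running times and closure properties of polynomial-time computability.

theorem Prog.Runs.size_lt {c : Prog} {x y : Data α} {n : ℕ} (h : c.Runs x y n) :
    x.size < n := by
  induction h <;> omega

/-- An elementary operation pays for its whole argument, so time bounds output size. This makes `PT`
closed under composition: the second program starts from a polynomially large value. -/
theorem Prog.Runs.size_le {c : Prog} {x y : Data α} {n : ℕ} (h : c.Runs x y n) : y.size ≤ n := by
  induction h with
  | prim o x =>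
    cases o with
    | le =>
      rcases x with _ | _ | ⟨_ | _ | _, _ | _ | _⟩ <;> simp only [Prim.apply] <;>
        (try split) <;> simp [Data.size]
    | _ => cases x <;> simp [Prim.apply, Data.size] <;> omega
  | loop_stop h => have := h.size_lt; omega
  | pair => simp only [Data.size]; omega
  | _ => omega

theorem Prog.Runs.loop_iterate {t f : Prog} (n T : ℕ) (s : ℕ → Data α)
    (htest : ∀ i < n, ∃ b m, t.Runs (s i) b m ∧ b ≠ .nil ∧ m ≤ T)
    (hbody : ∀ i < n, ∃ m, f.Runs (s i) (s (i + 1)) m ∧ m ≤ T)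
    (hdone : ∃ m, t.Runs (s n) .nil m ∧ m ≤ T) :
    ∃ m, (Prog.loop t f).Runs (s 0) (s n) m ∧ m ≤ (n + 1) * (2 * T + 1) := by
  induction n generalizing s with
  | zero =>
    obtain ⟨m, h, hm⟩ := hdone
    have hrun := Prog.Runs.loop_stop (f := f) h
    exact ⟨_, hrun, by omega⟩
  | succ n ih =>
    obtain ⟨b, m₁, h₁, hb, hm₁⟩ := htest 0 (by omega)
    obtain ⟨m₂, h₂, hm₂⟩ := hbody 0 (by omega)
    obtain ⟨m₃, h₃, hm₃⟩ := ih (fun i => s (i + 1)) (fun i hi => htest (i + 1) (by omega))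
      (fun i hi => hbody (i + 1) (by omega)) hdone
    exact ⟨_, .loop_step h₁ hb h₂ h₃, by rw [add_mul (n + 1)]; omega⟩

/-- `f` is computed by a program in polynomial time. -/
def PT (α : Type u) [LinearOrder α] [OrderBot α] {β γ : Type*} [Enc α β] [Enc α γ]
    (f : β → γ) : Prop :=
  ∃ (c : Prog) (T : β → ℕ), PolyBdd α T ∧
    ∀ b, ∃ n, c.Runs (Enc.enc b : Data α) (Enc.enc (f b)) n ∧ n ≤ T b

namespace PT

variable {β γ δ σ : Type*} [Enc α β] [Enc α γ] [Enc α δ] [Enc α σ]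

theorem polyBdd {f : β → γ} (hf : PT α f) : PolyBdd α fun b => sz α (f b) := by
  obtain ⟨c, T, hT, h⟩ := hf
  refine hT.mono fun b => ?_
  obtain ⟨n, hn, hnT⟩ := h b
  exact hn.size_le.trans hnT

/-- Only the encodings have to agree, so the identity operation also computes maps that are
invisible in the encoding, such as `Option.some` or `Edge.isDesc`. -/
theorem prim (o : Prim) {f : β → γ} (h : ∀ b, (Enc.enc (f b) : Data α) = o.apply (Enc.enc b)) :
    PT α f :=
  ⟨.prim o, fun b => 1 + sz α b, (PolyBdd.const 1).add .size, fun b => ⟨_, h b ▸ .prim o _, le_rfl⟩⟩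

theorem id : PT α fun b : β => b := prim .id fun _ => rfl

theorem comp {g : γ → δ} {f : β → γ} (hg : PT α g) (hf : PT α f) : PT α fun b => g (f b) := by
  have hs := hf.polyBdd
  obtain ⟨c, T, hT, h⟩ := hf
  obtain ⟨c', T', ⟨P, hP⟩, h'⟩ := hg
  refine ⟨.comp c' c, fun b => T b + P.eval (sz α (f b)) + 1, (hT.add (hs.eval P)).add (.const 1),
    fun b => ?_⟩
  obtain ⟨n, hn, hnT⟩ := h b
  obtain ⟨n', hn', hnT'⟩ := h' (f b)
  have := hP (f b)
  exact ⟨_, .comp hn hn', by beta_reduce; omega⟩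

theorem _root_.PolyBdd.comp {g : γ → ℕ} {f : β → γ} (hg : PolyBdd α g) (hf : PT α f) :
    PolyBdd α fun b => g (f b) := by
  obtain ⟨P, hP⟩ := hg
  exact (hf.polyBdd.eval P).mono fun b => hP _

theorem pair {f : β → γ} {g : β → δ} (hf : PT α f) (hg : PT α g) : PT α fun b => (f b, g b) := by
  obtain ⟨c, T, hT, h⟩ := hf
  obtain ⟨c', T', hT', h'⟩ := hg
  refine ⟨.pair c c', fun b => T b + T' b + 1, (hT.add hT').add (.const 1), fun b => ?_⟩
  obtain ⟨n, hn, hnT⟩ := h b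
  obtain ⟨n', hn', hnT'⟩ := h' b
  exact ⟨_, .pair hn hn', by beta_reduce; omega⟩

theorem fst {f : β → γ × δ} (hf : PT α f) : PT α fun b => (f b).1 :=
  (prim .head fun _ => rfl : PT α fun p : γ × δ => p.1).comp hf

theorem snd {f : β → γ × δ} (hf : PT α f) : PT α fun b => (f b).2 :=
  (prim .tail fun _ => rfl : PT α fun p : γ × δ => p.2).comp hf

theorem nil : PT α fun _ : β => ([] : List γ) := prim .nil fun _ => rfl

theorem unit : PT α fun _ : β => () := prim .nil fun _ => rfl

theorem none : PT α fun _ : β => (Option.none : Option α) := prim .nil fun _ => rfl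

theorem some {f : β → α} (hf : PT α f) : PT α fun b => Option.some (f b) :=
  (prim .id fun _ => rfl : PT α fun a : α => Option.some a).comp hf

theorem boolConst (v : Bool) : PT α fun _ : β => v := by
  cases v
  · exact prim .nil fun _ => rfl
  -- The encoding of `true` is that of the pair `((), ())`.
  · obtain ⟨c, T, hT, h⟩ := (unit (α := α) (β := β)).pair unit
    exact ⟨c, T, hT, h⟩

theorem edgeConst (e : Edge) : PT α fun _ : β => e := by
  cases e
  · exact prim .nil fun _ => rfl
  · obtain ⟨c, T, hT, h⟩ := (unit (α := α) (β := β)).pair unit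
    exact ⟨c, T, hT, h⟩

theorem cons {f : β → γ} {g : β → List γ} (hf : PT α f) (hg : PT α g) :
    PT α fun b => f b :: g b := by
  -- A list cell is encoded as the pair of its head and its tail.
  obtain ⟨c, T, hT, h⟩ := hf.pair hg
  exact ⟨c, T, hT, h⟩

theorem singleton {f : β → γ} (hf : PT α f) : PT α fun b => [f b] := hf.cons nil

theorem le {f g : β → α} (hf : PT α f) (hg : PT α g) : PT α fun b => decide (f b ≤ g b) :=
  (prim .le (fun p => by simp [Enc.enc, Prim.apply]) :
    PT α fun p : α × α => decide (p.1 ≤ p.2)).comp (hf.pair hg)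

theorem cond {t : β → Bool} {f g : β → γ} (ht : PT α t) (hf : PT α f) (hg : PT α g) :
    PT α fun b => bif t b then f b else g b := by
  obtain ⟨c₀, T₀, hT₀, h₀⟩ := ht
  obtain ⟨c₁, T₁, hT₁, h₁⟩ := hf
  obtain ⟨c₂, T₂, hT₂, h₂⟩ := hg
  refine ⟨.cond c₀ c₁ c₂, fun b => T₀ b + T₁ b + T₂ b + 1, ((hT₀.add hT₁).add hT₂).add (.const 1),
    fun b => ?_⟩
  obtain ⟨n₀, hn₀, hnT₀⟩ := h₀ b
  obtain ⟨n₁, hn₁, hnT₁⟩ := h₁ b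
  obtain ⟨n₂, hn₂, hnT₂⟩ := h₂ b
  beta_reduce
  cases hb : t b
  · rw [hb] at hn₀
    exact ⟨_, .cond_false hn₀ hn₂, by omega⟩
  · rw [hb] at hn₀
    exact ⟨_, .cond_true hn₀ (by simp [Enc.enc]) hn₁, by omega⟩

theorem and {f g : β → Bool} (hf : PT α f) (hg : PT α g) : PT α fun b => f b && g b := by
  convert hf.cond hg (boolConst false) using 2 with b
  cases f b <;> rfl

theorem or {f g : β → Bool} (hf : PT α f) (hg : PT α g) : PT α fun b => f b || g b := by
  convert hf.cond (boolConst true) hg using 2 with b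
  cases f b <;> rfl

theorem not {f : β → Bool} (hf : PT α f) : PT α fun b => !f b := by
  convert hf.cond (boolConst false) (boolConst true) using 2 with b
  cases f b <;> rfl

theorem eq {f g : β → α} (hf : PT α f) (hg : PT α g) : PT α fun b => decide (f b = g b) := by
  convert (hf.le hg).and (hg.le hf) using 2 with b
  simp [le_antisymm_iff]

/-- Case distinction on a list. -/
theorem listCases {l : β → List γ} {g : β → δ} {h : β × γ × List γ → δ} {f : β → δ}
    (hl : PT α l) (hg : PT α g) (hh : PT α h) (h_nil : ∀ b, l b = [] → f b = g b)
    (h_cons : ∀ b x xs, l b = x :: xs → f b = h (b, x, xs)) : PT α f := by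
  have hs := hl.polyBdd
  obtain ⟨c₀, T₀, hT₀, h₀⟩ := hl
  obtain ⟨c₁, T₁, hT₁, h₁⟩ := hg
  obtain ⟨c₂, T₂, ⟨P, hP⟩, h₂⟩ := hh
  -- The program `c₀` runs twice, hence `2 * T₀`: once as the test, since only the empty list is
  -- encoded by `nil`, and once to supply the encoding of `(x, xs)`, which is the same as that of `x
  -- :: xs`.
  refine ⟨.cond c₀ (.comp c₂ (.pair (.prim .id) c₀)) c₁,
    fun b => 2 * T₀ b + T₁ b + P.eval (1 + sz α b + sz α (l b)) + (1 + sz α b) + 3,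
    (((((PolyBdd.const 2).mul hT₀).add hT₁).add
      (PolyBdd.eval P (((PolyBdd.const 1).add .size).add hs))).add
      ((PolyBdd.const 1).add .size)).add (.const 3), fun b => ?_⟩
  obtain ⟨n₀, hn₀, hnT₀⟩ := h₀ b
  obtain ⟨n₁, hn₁, hnT₁⟩ := h₁ b
  cases hb : l b with
  | nil =>
    rw [hb] at hn₀
    rw [h_nil b hb]
    exact ⟨_, .cond_false hn₀ hn₁, by beta_reduce; omega⟩
  | cons x xs =>
    obtain ⟨n₂, hn₂, hnT₂⟩ := h₂ (b, x, xs)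
    have hp := hP (b, x, xs)
    rw [hb] at hn₀
    rw [h_cons b x xs hb]
    refine ⟨_, .cond_true hn₀ (by simp [Enc.enc, Data.ofList])
      (.comp (.pair (.prim .id _) hn₀) hn₂), ?_⟩
    beta_reduce
    rw [hb, show (Enc.enc b : Data α).size = sz α b from rfl]
    simp only [sz_prod, sz_cons] at *
    omega

/-- Case distinction on an optional label. -/
theorem optionCases {o : β → Option α} {g : β → δ} {h : β × α → δ} {f : β → δ}
    (ho : PT α o) (hg : PT α g) (hh : PT α h) (h_none : ∀ b, o b = .none → f b = g b)
    (h_some : ∀ b a, o b = .some a → f b = h (b, a)) : PT α f := by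
  obtain ⟨c₀, T₀, hT₀, h₀⟩ := ho
  obtain ⟨c₁, T₁, hT₁, h₁⟩ := hg
  obtain ⟨c₂, T₂, ⟨P, hP⟩, h₂⟩ := hh
  refine ⟨.cond c₀ (.comp c₂ (.pair (.prim .id) c₀)) c₁,
    fun b => 2 * T₀ b + T₁ b + P.eval (1 + sz α b + 1) + (1 + sz α b) + 3,
    (((((PolyBdd.const 2).mul hT₀).add hT₁).add
      (PolyBdd.eval P (((PolyBdd.const 1).add .size).add (.const 1)))).add
      ((PolyBdd.const 1).add .size)).add (.const 3), fun b => ?_⟩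
  obtain ⟨n₀, hn₀, hnT₀⟩ := h₀ b
  obtain ⟨n₁, hn₁, hnT₁⟩ := h₁ b
  cases hb : o b with
  | none =>
    rw [hb] at hn₀
    rw [h_none b hb]
    exact ⟨_, .cond_false hn₀ hn₁, by beta_reduce; omega⟩
  | some a =>
    obtain ⟨n₂, hn₂, hnT₂⟩ := h₂ (b, a)
    have hp := hP (b, a)
    rw [hb] at hn₀
    rw [h_some b a hb]
    refine ⟨_, .cond_true hn₀ (by simp [Enc.enc, encodeLabel])
      (.comp (.pair (.prim .id _) hn₀) hn₂), ?_⟩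
    have hp : T₂ (b, a) ≤ P.eval (1 + sz α b + 1) := hp
    beta_reduce
    rw [show (Enc.enc b : Data α).size = sz α b from rfl]
    omega

theorem isSome {f : β → Option α} (hf : PT α f) : PT α fun b => (f b).isSome :=
  hf.optionCases (boolConst false) (boolConst true) (fun b h => by simp [h])
    (fun b a h => by simp [h])

theorem isEmpty {f : β → List γ} (hf : PT α f) : PT α fun b => (f b).isEmpty :=
  hf.listCases (boolConst true) (boolConst false) (fun b h => by simp [h])
    (fun b a l h => by simp [h])

/-- A loop that stops after polynomially many rounds and whose states have polynomial size. -/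
theorem iterate {test : σ → Bool} {step : σ → σ} {init : β → σ} {n : β → ℕ} (ht : PT α test)
    (hs : PT α step) (hi : PT α init) (hn : PolyBdd α n) (B : β → ℕ) (hB : PolyBdd α B)
    (hsize : ∀ b, ∀ i ≤ n b, sz α (step^[i] (init b)) ≤ B b)
    (hgo : ∀ b, ∀ i < n b, test (step^[i] (init b)) = true)
    (hdone : ∀ b, test (step^[n b] (init b)) = false) :
    PT α fun b => step^[n b] (init b) := by
  obtain ⟨c₀, T₀, ⟨P₀, hP₀⟩, h₀⟩ := ht
  obtain ⟨c₁, T₁, ⟨P₁, hP₁⟩, h₁⟩ := hs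
  obtain ⟨c₂, T₂, hT₂, h₂⟩ := hi
  refine ⟨.comp (.loop c₀ c₁) c₂,
    fun b => T₂ b + (n b + 1) * (2 * (P₀.eval (B b) + P₁.eval (B b)) + 1) + 1,
    (hT₂.add ((hn.add (.const 1)).mul (((PolyBdd.const 2).mul
      ((hB.eval P₀).add (hB.eval P₁))).add (.const 1)))).add (.const 1), fun b => ?_⟩
  obtain ⟨k, hk, hkT⟩ := h₂ b
  have hT₀ : ∀ i ≤ n b, T₀ (step^[i] (init b)) ≤ P₀.eval (B b) := fun i hi =>
    (hP₀ _).trans (P₀.eval_mono_nat (hsize b i hi))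
  have hT₁ : ∀ i ≤ n b, T₁ (step^[i] (init b)) ≤ P₁.eval (B b) := fun i hi =>
    (hP₁ _).trans (P₁.eval_mono_nat (hsize b i hi))
  obtain ⟨m, hm, hmT⟩ := Prog.Runs.loop_iterate (t := c₀) (f := c₁) (n b)
    (P₀.eval (B b) + P₁.eval (B b)) (fun i => (Enc.enc (step^[i] (init b)) : Data α))
    (fun i hi => by
      obtain ⟨m, hm, hmT⟩ := h₀ (step^[i] (init b))
      have := hT₀ i hi.le
      exact ⟨_, m, hm, by simp [hgo b i hi, Enc.enc], by omega⟩)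
    (fun i hi => by
      obtain ⟨m, hm, hmT⟩ := h₁ (step^[i] (init b))
      have := hT₁ i hi.le
      rw [Function.iterate_succ_apply']
      exact ⟨m, hm, by omega⟩)
    (by
      obtain ⟨m, hm, hmT⟩ := h₀ (step^[n b] (init b))
      have := hT₀ (n b) le_rfl
      rw [hdone b] at hm
      exact ⟨m, hm, by omega⟩)
  exact ⟨_, .comp hk hm, by beta_reduce; omega⟩

/-- The loop state consists of the parameter, the accumulator and the rest of the list. The
accumulators that occur are the folds over prefixes, so these are the values whose size must be
bounded. -/
theorem foldl {f : β → σ → γ → σ} {l : β → List γ} {init : β → σ}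
    (hf : PT α fun p : β × σ × γ => f p.1 p.2.1 p.2.2) (hl : PT α l) (hi : PT α init) (B : β → ℕ)
    (hB : PolyBdd α B) (hsize : ∀ b l₁, l₁ <+: l b → sz α (l₁.foldl (f b) (init b)) ≤ B b) :
    PT α fun b => (l b).foldl (f b) (init b) := by
  let step : β × σ × List γ → β × σ × List γ := fun s =>
    match s.2.2 with
    | [] => s
    | x :: xs => (s.1, f s.1 s.2.1 x, xs)
  have hstep : PT α step := by
    refine listCases (l := fun s : β × σ × List γ => s.2.2) id.snd.snd id
      (h := fun p => (p.1.1, f p.1.1 p.1.2.1 p.2.1, p.2.2))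
      (id.fst.fst.pair ((hf.comp (id.fst.fst.pair (id.fst.snd.fst.pair id.snd.fst))).pair
        id.snd.snd)) (fun s h => by simp [step, h]) (fun s x xs h => by simp [step, h])
  have key : ∀ b i, i ≤ (l b).length →
      step^[i] (b, init b, l b) = (b, ((l b).take i).foldl (f b) (init b), (l b).drop i) := by
    intro b i hi
    induction i with
    | zero => simp
    | succ i ih =>
      rw [Function.iterate_succ_apply', ih (by omega)]
      rw [List.drop_eq_getElem_cons (show i < (l b).length by omega)]
      simp only [step]
      rw [List.take_succ_eq_append_getElem (by omega), List.foldl_append]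
      rfl
  have := iterate (α := α) (test := fun s : β × σ × List γ => !s.2.2.isEmpty) (step := step)
    (init := fun b => (b, init b, l b)) (n := fun b => (l b).length)
    id.snd.snd.isEmpty.not hstep (id.pair (hi.pair hl))
    (hl.polyBdd.mono fun b => (length_lt_sz (α := α) _).le)
    (fun b => 1 + sz α b + (1 + B b + sz α (l b)))
    (((PolyBdd.const 1).add .size).add (((PolyBdd.const 1).add hB).add hl.polyBdd))
    (fun b i hi => by
      rw [key b i hi]
      have h₁ := hsize b _ (List.take_prefix i _)
      have h₂ : sz α ((l b).drop i) ≤ sz α (l b) := by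
        have := sz_append (α := α) ((l b).take i) ((l b).drop i)
        rw [List.take_append_drop] at this
        have := sz_pos (α := α) ((l b).take i)
        omega
      simp only [sz_prod]; omega)
    (fun b i hi => by rw [key b i hi.le]; simp; omega)
    (fun b => by rw [key b _ le_rfl]; simp)
  convert this.snd.fst using 2 with b
  rw [key b _ le_rfl]; simp

theorem reverse {l : β → List γ} (hl : PT α l) : PT α fun b => (l b).reverse := by
  have := foldl (α := α) (f := fun (_ : β) (acc : List γ) x => x :: acc) (init := fun _ => [])
    (id.snd.snd.cons id.snd.fst) hl nil _ hl.polyBdd (fun b l₁ h => by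
      obtain ⟨l₂, h⟩ := h
      have h₁ := sz_append (α := α) l₁ l₂
      have h₂ := sz_pos (α := α) l₂
      rw [h] at h₁
      rw [show l₁.foldl (fun acc x => x :: acc) [] = l₁.reverse by simp, sz_reverse]
      omega)
  convert this using 2 with b
  simp

/-- A left fold over the reversed list; the intermediate values now belong to suffixes. -/
theorem foldr {f : β → γ → σ → σ} {l : β → List γ} {init : β → σ}
    (hf : PT α fun p : β × γ × σ => f p.1 p.2.1 p.2.2) (hl : PT α l) (hi : PT α init) (B : β → ℕ)
    (hB : PolyBdd α B) (hsize : ∀ b l₁, l₁ <:+ l b → sz α (l₁.foldr (f b) (init b)) ≤ B b) :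
    PT α fun b => (l b).foldr (f b) (init b) := by
  have := foldl (α := α) (f := fun b s x => f b x s) (init := init) (l := fun b => (l b).reverse)
    (hf.comp (id.fst.pair (id.snd.snd.pair id.snd.fst))) hl.reverse hi B hB (fun b l₁ h => by
      have := hsize b l₁.reverse (by rw [← List.reverse_prefix]; simpa using h)
      simpa using this)
  simpa using this

theorem append {l l' : β → List γ} (hl : PT α l) (hl' : PT α l') : PT α fun b => l b ++ l' b := by
  have := foldr (α := α) (f := fun (_ : β) x (acc : List γ) => x :: acc) (init := l')
    (id.snd.fst.cons id.snd.snd) hl hl' _ (hl.polyBdd.add hl'.polyBdd) (fun b l₁ h => by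
      obtain ⟨l₂, h⟩ := h
      have h₁ := sz_append (α := α) l₂ l₁
      have h₂ := sz_append (α := α) l₁ (l' b)
      have h₃ := sz_pos (α := α) l₂
      rw [h] at h₁
      rw [show l₁.foldr (fun x acc => x :: acc) (l' b) = l₁ ++ l' b by simp]
      omega)
  simpa using this

theorem map {f : β → γ → δ} {l : β → List γ} (hf : PT α fun p : β × γ => f p.1 p.2)
    (hl : PT α l) : PT α fun b => (l b).map (f b) := by
  obtain ⟨P, hP⟩ := hf.polyBdd
  have := foldr (α := α) (f := fun (b : β) x (acc : List δ) => f b x :: acc) (init := fun _ => [])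
    ((hf.comp (id.fst.pair id.snd.fst)).cons id.snd.snd) hl nil
    (fun b => sz α (l b) * (P.eval (1 + sz α b + sz α (l b)) + 1) + 1)
    ((hl.polyBdd.mul ((PolyBdd.eval P (((PolyBdd.const 1).add .size).add hl.polyBdd)).add
      (.const 1))).add (.const 1))
    (fun b l₁ h => by
      rw [show l₁.foldr (fun x acc => f b x :: acc) [] = l₁.map (f b) by
        induction l₁ <;> simp_all]
      have h₁ : ∀ y ∈ l₁.map (f b), sz α y ≤ P.eval (1 + sz α b + sz α (l b)) := by
        intro y hy
        obtain ⟨x, hx, rfl⟩ := List.mem_map.1 hy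
        refine (hP (b, x)).trans (P.eval_mono_nat ?_)
        have := sz_le_of_mem (α := α) (h.subset hx)
        simp only [sz_prod]; omega
      refine (sz_list_le h₁).trans (Nat.add_le_add_right (Nat.mul_le_mul_right _ ?_) 1)
      have := h.length_le
      have := length_lt_sz (α := α) (l b)
      simp only [List.length_map]; omega)
  convert this using 2 with b
  induction l b <;> simp_all

theorem flatten {l : β → List (List γ)} (hl : PT α l) : PT α fun b => (l b).flatten := by
  have hb : ∀ l : List (List γ), sz α l.flatten ≤ sz α l := by
    intro l
    induction l with
    | nil => simp
    | cons x l ih => have := sz_append (α := α) x l.flatten; simp; omega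
  have := foldr (α := α) (f := fun (_ : β) x (acc : List γ) => x ++ acc) (init := fun _ => [])
    (id.snd.fst.append id.snd.snd) hl nil _ hl.polyBdd (fun b l₁ h => by
      rw [show l₁.foldr (fun x acc => x ++ acc) [] = l₁.flatten by
        clear h; induction l₁ <;> simp_all]
      obtain ⟨l₂, h⟩ := h
      have h₁ := sz_append (α := α) l₂ l₁
      have h₂ := sz_pos (α := α) l₂
      have := hb l₁
      rw [h] at h₁
      omega)
  convert this using 2 with b
  induction l b <;> simp_all

theorem flatMap {f : β → γ → List δ} {l : β → List γ} (hf : PT α fun p : β × γ => f p.1 p.2)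
    (hl : PT α l) : PT α fun b => (l b).flatMap (f b) := (hf.map hl).flatten

theorem filter {f : β → γ → Bool} {l : β → List γ} (hf : PT α fun p : β × γ => f p.1 p.2)
    (hl : PT α l) : PT α fun b => (l b).filter (f b) := by
  convert flatMap (α := α) (f := fun b x => bif f b x then [x] else []) (hf.cond id.snd.singleton nil)
    hl using 2 with b
  induction l b with
  | nil => rfl
  | cons x l ih => cases h : f b x <;> simp [h, ih]

theorem any {f : β → γ → Bool} {l : β → List γ} (hf : PT α fun p : β × γ => f p.1 p.2)
    (hl : PT α l) : PT α fun b => (l b).any (f b) := by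
  convert (filter hf hl).isEmpty.not using 2 with b
  induction l b with
  | nil => rfl
  | cons x l ih => cases h : f b x <;> simp [h, ih]

theorem all {f : β → γ → Bool} {l : β → List γ} (hf : PT α fun p : β × γ => f p.1 p.2)
    (hl : PT α l) : PT α fun b => (l b).all (f b) := by
  convert (any (α := α) (f := fun b x => !f b x) hf.not hl).not using 2 with b
  induction l b with
  | nil => rfl
  | cons x l ih => cases h : f b x <;> simp [h, ih]

/-- The encoding of the edge kinds is the one of the Booleans. -/
def _root_.Edge.isDesc : Edge → Bool
  | .child => false
  | .desc => true

theorem isDesc {f : β → Edge} (hf : PT α f) : PT α fun b => (f b).isDesc :=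
  (prim .id (by rintro (_ | _) <;> rfl) : PT α Edge.isDesc).comp hf

theorem label {f : β → LTree α} (hf : PT α f) : PT α fun b => (f b).label :=
  (prim .head (by rintro ⟨a, ts⟩; rfl) : PT α (LTree.label : LTree α → α)).comp hf

end PT

-- Trees as encoded data.

/-- The immediate subtrees. -/
def LTree.children {α : Type u} : LTree α → List (LTree α)
  | .node _ ts => ts

theorem LTree.encodeList_eq {α : Type u} (ts : List (LTree α)) :
    LTree.encodeList ts = Enc.enc ts := by
  induction ts with
  | nil => rfl
  | cons t ts ih => rw [LTree.encodeList, ih]; rfl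

theorem PT.children {β : Type*} [Enc α β] {f : β → LTree α} (hf : PT α f) :
    PT α fun b => (f b).children :=
  (prim .tail (by rintro ⟨a, ts⟩; exact (LTree.encodeList_eq ts).symm) :
    PT α (LTree.children : LTree α → List (LTree α))).comp hf

mutual
-- Each node costs four units: its pair, its label, the end of its list of children, and its cell in
-- the list of its parent. The root has no such cell.
theorem LTree.sz_add_one_le {α : Type u} : ∀ t : LTree α, sz α t + 1 ≤ 4 * t.size
  | .node a ts => by
    have := LTree.sz_list_le ts
    rw [← LTree.encodeList_eq] at this
    simp only [sz, Enc.enc, LTree.encode, Data.size, LTree.size]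
    omega
theorem LTree.sz_list_le {α : Type u} :
    ∀ ts : List (LTree α), (Enc.enc ts : Data α).size ≤ 4 * LTree.sizeList ts + 1
  | [] => by simp [Enc.enc, Data.ofList, Data.size]
  | t :: ts => by
    have h₁ := LTree.sz_add_one_le t
    have h₂ := LTree.sz_list_le ts
    have h₃ : (Enc.enc (t :: ts) : Data α).size = 1 + sz α t + (Enc.enc ts : Data α).size := rfl
    simp only [LTree.sizeList]
    omega
end

/-- The part of a path query below its root. -/
abbrev Steps (α : Type u) : Type u := List (Edge × Option α)

section paths

variable {α : Type u}

@[simp] theorem isDesc_eq_false {e : Edge} : e.isDesc = false ↔ e = .child := by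
  cases e <;> simp [Edge.isDesc]

@[simp] theorem isDesc_eq_true {e : Edge} : e.isDesc = true ↔ e = .desc := by
  cases e <;> simp [Edge.isDesc]

/-- A measure of how specific a path is. -/
def meas : Steps α → ℕ
  | [] => 0
  | (e, x) :: p => 1 + (bif e.isDesc then 0 else 1) + (bif x.isSome then 1 else 0) + meas p

theorem meas_append (p q : Steps α) : meas (p ++ q) = meas p + meas q := by
  induction p with
  | nil => simp [meas]
  | cons s p ih => simp [meas, ih]; omega

theorem meas_le (p : Steps α) : meas p ≤ 3 * p.length := by
  induction p with
  | nil => simp [meas]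
  | cons s p ih =>
    obtain ⟨_ | _, _ | x⟩ := s <;> simp [meas, Edge.isDesc] <;> omega

/-! ### Anchored paths -/

/-- The path query is anchored; its root plays no role. -/
def anch : Steps α → Bool
  | [] => true
  | (e, x) :: p =>
    (x.isSome || (match p with | [] => e.isDesc | s :: _ => !e.isDesc && !s.1.isDesc)) && anch p

@[simp] theorem anch_nil : anch ([] : Steps α) = true := rfl

@[simp] theorem anch_some (e : Edge) (a : α) (p : Steps α) :
    anch ((e, some a) :: p) = true ↔ anch p = true := by simp [anch]

@[simp] theorem anch_none_nil (e : Edge) : anch [(e, (none : Option α))] = true ↔ e = .desc := by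
  simp [anch]

@[simp] theorem anch_none_cons (e e' : Edge) (x : Option α) (p : Steps α) :
    anch ((e, none) :: (e', x) :: p) = true ↔
      e = .child ∧ e' = .child ∧ anch ((e', x) :: p) = true := by
  rw [anch]; simp [and_assoc]

theorem anch_tail {s : Edge × Option α} {p : Steps α} (h : anch (s :: p) = true) :
    anch p = true := by
  unfold anch at h; simp at h; exact h.2

theorem anch_none {e : Edge} {p : Steps α} (h : anch ((e, none) :: p) = true) :
    (e = .desc ∧ p = []) ∨ (e = .child ∧ ∃ x p', p = (.child, x) :: p') := by
  rcases p with _ | ⟨⟨e', x⟩, p⟩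
  · simpa using h
  · rw [anch_none_cons] at h
    obtain ⟨rfl, rfl, -⟩ := h
    exact .inr ⟨rfl, x, p, rfl⟩

/-- A non-leaf star touches only child edges, but a star leaf needs a descendant edge above it. So
two consecutive stars cannot end a path. -/
theorem anch_stars {p : Steps α} (h : anch p = true) (hp : ∀ e a, (e, some a) ∉ p) :
    p = [] ∨ p = [(.desc, none)] := by
  induction p with
  | nil => simp
  | cons s p ih =>
    obtain ⟨e, _ | a⟩ := s
    · right
      rcases anch_none h with ⟨rfl, rfl⟩ | ⟨rfl, x, p', rfl⟩
      · rfl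
      · have := ih (anch_tail h) fun e a ha => hp e a (List.mem_cons_of_mem _ ha)
        simp at this
    · exact absurd (List.mem_cons_self ..) (hp e a)

/-- None of the stars in `u` is the leaf, so none touches a descendant edge. -/
theorem anch_append_stars {u : Steps α} {e : Edge} {x : Option α} {p : Steps α}
    (h : anch (u ++ (e, x) :: p) = true) (hu : ∀ e a, (e, some a) ∉ u) (hu' : u ≠ []) :
    e = .child ∧ ∃ k, u = List.replicate k (.child, none) := by
  induction u with
  | nil => simp at hu'
  | cons s u ih =>
    obtain ⟨e', _ | a⟩ := s
    · rcases u with _ | ⟨s', u⟩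
      · simp only [List.cons_append, List.nil_append, anch_none_cons] at h
        obtain ⟨rfl, rfl, -⟩ := h
        exact ⟨rfl, 1, rfl⟩
      · obtain ⟨rfl, k, hk⟩ := ih (anch_tail h)
          (fun e a ha => hu e a (List.mem_cons_of_mem _ ha)) (by simp)
        obtain ⟨e'', x''⟩ := s'
        simp only [List.cons_append, anch_none_cons] at h
        obtain ⟨rfl, -, -⟩ := h
        exact ⟨rfl, k + 1, by rw [hk, List.replicate_succ]⟩
    · exact absurd (List.mem_cons_self ..) (hu e' a)

theorem anch_replicate_append {k : ℕ} {x : Option α} {p : Steps α}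
    (h : anch ((.child, x) :: p) = true) :
    anch (List.replicate k (.child, none) ++ (.child, x) :: p) = true := by
  induction k with
  | zero => exact h
  | succ k ih =>
    rw [List.replicate_succ, List.cons_append]
    cases k with
    | zero => simpa using h
    | succ k =>
      rw [List.replicate_succ, List.cons_append] at ih ⊢
      rw [anch_none_cons]
      exact ⟨rfl, rfl, ih⟩

/-! ### Refinements of a path -/

/-- The paths obtained from `(e, x) :: p` by an elementary refinement of its first step, with
labels from `A` and sequences of stars from `N`. -/
def refineFirst (A : List α) (N : List (Steps α)) (e : Edge) (x : Option α) (p : Steps α) :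
    List (Steps α) :=
  match x with
  | none => A.map fun a => (e, some a) :: p
  | some b => bif e.isDesc then
      A.map (fun a => (.desc, some a) :: (.desc, some b) :: p) ++
        N.map (fun n => n ++ (.child, some b) :: p)
    else []

/-- The elementary refinements of a path. -/
def refinements (A : List α) (N : List (Steps α)) : Steps α → List (Steps α)
  | [] => [(.desc, none)] :: A.map fun a => [(.desc, some a)]
  | (e, x) :: p => refineFirst A N e x p ++ (refinements A N p).map ((e, x) :: ·)

theorem meas_lt_of_mem_refinements {A : List α} {N : List (Steps α)} {p p' : Steps α}
    (h : p' ∈ refinements A N p) : meas p < meas p' := by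
  induction p generalizing p' with
  | nil =>
    simp only [refinements, List.mem_cons, List.mem_map] at h
    rcases h with rfl | ⟨a, -, rfl⟩ <;> simp [meas]
  | cons s p ih =>
    obtain ⟨e, x⟩ := s
    simp only [refinements, List.mem_append, List.mem_map] at h
    rcases h with h | ⟨p', h, rfl⟩
    · cases x with
      | none =>
        simp only [refineFirst, List.mem_map] at h
        obtain ⟨a, -, rfl⟩ := h
        simp [meas]
      | some b =>
        cases e with
        | child => simp [refineFirst, Edge.isDesc] at h
        | desc =>
          simp only [refineFirst, Edge.isDesc, cond_true, List.mem_append, List.mem_map] at h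
          rcases h with ⟨a, -, rfl⟩ | ⟨n, -, rfl⟩
          · simp [meas, Edge.isDesc]
          · simp [meas, meas_append, Edge.isDesc]; omega
    · have := ih h
      simp only [meas]; omega

/-! ### Canonical words of a path -/

/-- The word obtained from a path by replacing every `⋆` by the label `c` and every descendant edge
by a path with `m` inner nodes labelled `c`. -/
def canon (m : ℕ) (c : α) : Steps α → List α
  | [] => []
  | (e, x) :: p => (bif e.isDesc then List.replicate m c else []) ++ x.getD c :: canon m c p

/-- A word as a path. -/
def wordSteps (w : List α) : Steps α := w.map fun a => (.child, some a)

@[simp] theorem wordSteps_cons (a : α) (w : List α) :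
    wordSteps (a :: w) = (.child, some a) :: wordSteps w := rfl

@[simp] theorem wordSteps_nil : wordSteps ([] : List α) = [] := rfl

theorem wordSteps_append (w w' : List α) :
    wordSteps (w ++ w') = wordSteps w ++ wordSteps w' := List.map_append ..

theorem length_canon_le (m : ℕ) (c : α) (p : Steps α) :
    (canon m c p).length ≤ p.length * (m + 1) := by
  induction p with
  | nil => simp [canon]
  | cons s p ih =>
    obtain ⟨_ | _, x⟩ := s <;> simp [canon, Edge.isDesc, add_mul, mul_add] at * <;> omega

theorem mem_canon {m : ℕ} {c a : α} {p : Steps α} (h : a ∈ canon m c p) :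
    a = c ∨ ∃ e, (e, some a) ∈ p := by
  induction p with
  | nil => simp [canon] at h
  | cons s p ih =>
    obtain ⟨e, x⟩ := s
    simp only [canon, List.mem_append, List.mem_cons] at h
    rcases h with h | h | h
    · cases e <;> simp [Edge.isDesc] at h
      exact .inl h.2
    · cases x with
      | none => exact .inl h
      | some b => exact .inr ⟨e, by simp at h; simp [h]⟩
    · exact (ih h).imp_right fun ⟨e, h⟩ => ⟨e, List.mem_cons_of_mem _ h⟩

end paths

/-! ### Homomorphisms between path queries -/

section combinatorics

variable {α : Type u} [DecidableEq α]

/-- `labLe x y`: a node labelled `x` may be mapped to a node labelled `y`. -/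
def labLe : Option α → Option α → Bool
  | none, _ => true
  | some _, none => false
  | some a, some b => decide (a = b)

@[simp] theorem labLe_none (y : Option α) : labLe none y = true := rfl

@[simp] theorem labLe_some (a : α) (y : Option α) : labLe (some a) y = true ↔ y = some a := by
  cases y <;> simp [labLe, eq_comm]

@[simp] theorem labLe_refl (x : Option α) : labLe x x = true := by cases x <;> simp

theorem labLe_trans {x y z : Option α} (h : labLe x y = true) (h' : labLe y z = true) :
    labLe x z = true := by
  cases x with
  | none => rfl
  | some a => rw [labLe_some] at h; rwa [h] at h'

/-- `emb p q`: there is a homomorphism from `p` to `q`, that is, a map that preserves the root,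
labels and child edges and sends descendant edges to nonempty paths. -/
def emb : Steps α → Steps α → Bool
  | [], _ => true
  | _ :: _, [] => false
  | (.child, x) :: p, (e, y) :: q => !e.isDesc && (labLe x y && emb p q)
  | (.desc, x) :: p, (_, y) :: q => labLe x y && emb p q || emb ((.desc, x) :: p) q
termination_by structural _ q => q

@[simp] theorem emb_nil (q : Steps α) : emb [] q = true := by cases q <;> rfl

@[simp] theorem emb_cons_nil (s : Edge × Option α) (p : Steps α) : emb (s :: p) [] = false := rfl

theorem emb_nil_right {p : Steps α} (h : emb p [] = true) : p = [] := by
  cases p <;> simp_all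

@[simp] theorem emb_child (x y : Option α) (e : Edge) (p q : Steps α) :
    emb ((.child, x) :: p) ((e, y) :: q) = true ↔
      e = .child ∧ labLe x y = true ∧ emb p q = true := by
  simp [emb]

theorem emb_desc (x y : Option α) (e : Edge) (p q : Steps α) :
    emb ((.desc, x) :: p) ((e, y) :: q) = true ↔
      (labLe x y = true ∧ emb p q = true) ∨ emb ((.desc, x) :: p) q = true := by
  conv_lhs => unfold emb
  simp

/-- The recursion for a descendant edge, unwound: `u` is the part of `q` that is skipped. -/
theorem emb_desc_iff (x : Option α) (p q : Steps α) :
    emb ((.desc, x) :: p) q = true ↔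
      ∃ u e y q', q = u ++ (e, y) :: q' ∧ labLe x y = true ∧ emb p q' = true := by
  induction q with
  | nil => simp
  | cons s q ih =>
    obtain ⟨e, y⟩ := s
    rw [emb_desc, ih]
    constructor
    · rintro (⟨h, h'⟩ | ⟨u, e', y', q', rfl, h, h'⟩)
      · exact ⟨[], e, y, q, rfl, h, h'⟩
      · exact ⟨(e, y) :: u, e', y', q', rfl, h, h'⟩
    · rintro ⟨u, e', y', q', hq, h, h'⟩
      cases u with
      | nil =>
        simp only [List.nil_append, List.cons.injEq, Prod.mk.injEq] at hq
        obtain ⟨⟨rfl, rfl⟩, rfl⟩ := hq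
        exact .inl ⟨h, h'⟩
      | cons s u =>
        simp only [List.cons_append, List.cons.injEq] at hq
        exact .inr ⟨u, e', y', q', hq.2, h, h'⟩

theorem emb_refl (p : Steps α) : emb p p = true := by
  induction p with
  | nil => rfl
  | cons s p ih =>
    obtain ⟨_ | _, x⟩ := s
    · simp [ih]
    · simp [emb_desc, ih]

theorem emb_trans {p q r : Steps α} (h : emb p q = true) (h' : emb q r = true) :
    emb p r = true := by
  induction r generalizing p q with
  | nil =>
    obtain rfl := emb_nil_right h'
    exact h
  | cons s r ih =>
    obtain ⟨e, z⟩ := s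
    rcases q with _ | ⟨⟨_ | _, y⟩, q⟩
    · rw [emb_nil_right h]; simp
    · rw [emb_child] at h'
      obtain ⟨rfl, hyz, h'⟩ := h'
      rcases p with _ | ⟨⟨_ | _, x⟩, p⟩
      · simp
      · rw [emb_child] at h ⊢
        exact ⟨rfl, labLe_trans h.2.1 hyz, ih h.2.2 h'⟩
      · rw [emb_desc] at h ⊢
        exact h.imp (fun h => ⟨labLe_trans h.1 hyz, ih h.2 h'⟩) fun h => ih h h'
    · rcases p with _ | ⟨⟨_ | _, x⟩, p⟩
      · simp
      · simp at h
      · rw [emb_desc] at h' ⊢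
        rcases h' with ⟨hyz, h'⟩ | h'
        · rw [emb_desc] at h
          exact h.imp (fun h => ⟨labLe_trans h.1 hyz, ih h.2 h'⟩) fun h => ih h h'
        · exact .inr (ih h h')

theorem labLe_isSome {x y : Option α} (h : labLe x y = true) :
    ((bif x.isSome then 1 else 0) ≤ (bif y.isSome then 1 else 0)) ∧
      ((bif y.isSome then 1 else 0) ≤ (bif x.isSome then 1 else 0) → x = y) := by
  cases x <;> cases y <;> simp_all

/-- Each step of `p` is charged to its image, which is at least as specific, and skipped steps of
`q` contribute positively. Equal measures thus force equality step by step. -/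
theorem emb_meas {p q : Steps α} (h : emb p q = true) :
    meas p ≤ meas q ∧ (meas q ≤ meas p → p = q) := by
  induction q generalizing p with
  | nil => simp [emb_nil_right h]
  | cons s q ih =>
    obtain ⟨e, y⟩ := s
    rcases p with _ | ⟨⟨_ | _, x⟩, p⟩
    · simp [meas]
    · rw [emb_child] at h
      obtain ⟨rfl, hxy, h⟩ := h
      obtain ⟨h₁, h₂⟩ := ih h
      obtain ⟨h₃, h₄⟩ := labLe_isSome hxy
      simp only [meas]
      exact ⟨by omega, fun hle => by rw [h₂ (by omega), h₄ (by omega)]⟩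
    · rw [emb_desc] at h
      rcases h with ⟨hxy, h⟩ | h
      · obtain ⟨h₁, h₂⟩ := ih h
        obtain ⟨h₃, h₄⟩ := labLe_isSome hxy
        cases e <;> simp only [meas, Edge.isDesc, cond_true, cond_false]
        · exact ⟨by omega, fun hle => by omega⟩
        · exact ⟨by omega, fun hle => by rw [h₂ (by omega), h₄ (by omega)]⟩
      · obtain ⟨h₁, h₂⟩ := ih h
        simp only [meas] at *
        omega

theorem emb_antisymm {p q : Steps α} (h : emb p q = true) (h' : emb q p = true) : p = q :=
  (emb_meas h).2 (emb_meas h').1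

theorem emb_length {p q : Steps α} (h : emb p q = true) : p.length ≤ q.length := by
  induction q generalizing p with
  | nil => simp [emb_nil_right h]
  | cons s q ih =>
    obtain ⟨e, y⟩ := s
    rcases p with _ | ⟨⟨_ | _, x⟩, p⟩
    · simp
    · rw [emb_child] at h
      simpa using ih h.2.2
    · rw [emb_desc] at h
      rcases h with h | h
      · simpa using ih h.2
      · have := ih h
        simp at *; omega

theorem emb_mem {p q : Steps α} (h : emb p q = true) {e : Edge} {a : α} (ha : (e, some a) ∈ p) :
    ∃ e', (e', some a) ∈ q := by
  induction q generalizing p with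
  | nil => simp [emb_nil_right h] at ha
  | cons s q ih =>
    obtain ⟨e₁, y⟩ := s
    have lift : (∃ e', (e', some a) ∈ q) → ∃ e', (e', some a) ∈ (e₁, y) :: q :=
      fun ⟨e', h⟩ => ⟨e', List.mem_cons_of_mem _ h⟩
    rcases p with _ | ⟨⟨e₂, x⟩, p⟩
    · simp at ha
    · have key : labLe x y = true → emb p q = true → ∃ e', (e', some a) ∈ (e₁, y) :: q := by
        intro hxy h
        rcases List.mem_cons.1 ha with ha | ha
        · obtain ⟨rfl, rfl⟩ := Prod.mk.injEq .. ▸ ha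
          rw [labLe_some] at hxy
          exact ⟨e₁, by simp [hxy]⟩
        · exact lift (ih h ha)
      cases e₂
      · rw [emb_child] at h
        exact key h.2.1 h.2.2
      · rw [emb_desc] at h
        exact h.elim (fun h => key h.1 h.2) fun h => lift (ih h ha)

theorem emb_singleton_desc {e : Edge} {a : α} {q : Steps α} (h : (e, some a) ∈ q) :
    emb [(.desc, some a)] q = true := by
  rw [emb_desc_iff]
  obtain ⟨u, v, rfl⟩ := List.append_of_mem h
  exact ⟨u, e, _, v, rfl, by simp, by simp⟩

/-- An anchored path that is strictly more general than the anchored path `q` has an elementary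
refinement that is anchored and at least as general as `q`. -/
theorem exists_mem_refinements {A : List α} {N : List (Steps α)} {p q : Steps α}
    (h : emb p q = true) (hp : anch p = true) (hq : anch q = true) (hne : p ≠ q)
    (hA : ∀ e a, (e, some a) ∈ q → a ∈ A)
    (hN : ∀ k ≤ q.length, List.replicate k (.child, none) ∈ N) :
    ∃ p' ∈ refinements A N p, anch p' = true ∧ emb p' q = true ∧
      ∀ x r, p = (.child, x) :: r → ∃ x' r', p' = (.child, x') :: r' := by
  induction p generalizing q with
  | nil =>
    by_cases hl : ∃ e a, (e, some a) ∈ q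
    · obtain ⟨e, a, ha⟩ := hl
      exact ⟨[(.desc, some a)], by simp [refinements, hA e a ha], by simp, emb_singleton_desc ha,
        by simp⟩
    -- Without labels, an anchored path is empty or a single descendant star.
    · push Not at hl
      obtain rfl : q = [(.desc, none)] := (anch_stars hq hl).resolve_left (Ne.symm hne)
      exact ⟨[(.desc, none)], by simp [refinements], by simp, emb_refl _, by simp⟩
  | cons s p ih =>
    -- The case where the first steps are matched and the tail is refined. A star put in front of
    -- the refined tail stays anchored only if that tail still starts with a child edge; the last
    -- conjunct of the statement carries this through the induction.
    have step : ∀ {e e' x y q'}, q = (e', y) :: q' → s = (e, x) → emb p q' = true →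
        p ≠ q' → (x = none → e = .child) →
        (∀ p', emb p' q' = true → emb ((e, x) :: p') ((e', y) :: q') = true) →
        ∃ p' ∈ refinements A N (s :: p), anch p' = true ∧ emb p' q = true ∧
          ∀ x r, s :: p = (.child, x) :: r → ∃ x' r', p' = (.child, x') :: r' := by
      rintro e e' x y q' rfl rfl h₁ h₂ h₃ h₄
      obtain ⟨p', hp', ha, he, hc⟩ := ih h₁ (anch_tail hp) (anch_tail hq) h₂
        (fun e a ha => hA e a (List.mem_cons_of_mem _ ha))
        (fun k hk => hN k (by simp; omega))
      refine ⟨(e, x) :: p', by simp [refinements, hp'], ?_, h₄ _ he, ?_⟩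
      · cases x with
        | some a => simpa using ha
        | none =>
          obtain rfl := h₃ rfl
          rcases anch_none hp with ⟨h, -⟩ | ⟨-, x, r, rfl⟩
          · simp at h
          · obtain ⟨x', r', rfl⟩ := hc x r rfl
            simpa using ha
      · intro x' r' h
        simp only [List.cons.injEq, Prod.mk.injEq] at h
        exact ⟨x, p', by rw [h.1.1]⟩
    obtain ⟨_ | _, x⟩ := s
    · rcases q with _ | ⟨⟨e, y⟩, q⟩
      · simp at h
      rw [emb_child] at h
      obtain ⟨rfl, hxy, h⟩ := h
      by_cases hxy' : x = y
      · subst hxy'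
        exact step rfl rfl h (by simpa using hne) (fun _ => rfl) fun p' hp' => by simpa using hp'
      · obtain ⟨rfl, a, rfl⟩ : x = none ∧ ∃ a, y = some a := by
          cases x <;> cases y <;> simp_all
        refine ⟨(.child, some a) :: p, ?_, by simpa using anch_tail hp, by simpa using h, by simp⟩
        simp [refinements, refineFirst, hA .child a (by simp)]
    · cases x with
      | none =>
        obtain rfl : p = [] := by
          rcases anch_none hp with ⟨-, h⟩ | ⟨h, -⟩
          · exact h
          · simp at h
        by_cases hl : ∃ e a, (e, some a) ∈ q
        · obtain ⟨e, a, ha⟩ := hl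
          exact ⟨[(.desc, some a)], by simp [refinements, refineFirst, hA e a ha], by simp,
            emb_singleton_desc ha, by simp⟩
        · push Not at hl
          rcases anch_stars hq hl with rfl | rfl
          · simp at h
          · exact absurd rfl hne
      | some a =>
        obtain ⟨u, e, y, q', rfl, hy, h'⟩ := (emb_desc_iff _ _ _).1 h
        obtain rfl := (labLe_some _ _).1 hy
        -- If the skipped part `u` contains a label `b`, a descendant node labelled `b` is inserted.
        by_cases hl : ∃ e a, (e, some a) ∈ u
        · obtain ⟨e', b, hb⟩ := hl
          refine ⟨(.desc, some b) :: (.desc, some a) :: p, ?_, by simpa using hp, ?_, by simp⟩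
          · simp [refinements, refineFirst, Edge.isDesc, hA e' b (by simp [hb])]
          · obtain ⟨v, w, rfl⟩ := List.append_of_mem hb
            rw [emb_desc_iff]
            exact ⟨v, e', some b, w ++ (e, some a) :: q', by simp, by simp,
              (emb_desc_iff _ _ _).2 ⟨w, e, some a, q', rfl, by simp, h'⟩⟩
        · push Not at hl
          -- Without a label in `u`, either the first steps agree, or anchoredness of `q` makes `u`
          -- a run of child stars followed by a child edge, and the descendant edge is replaced by
          -- exactly this run.
          by_cases hd : u = [] ∧ e = .desc
          · obtain ⟨rfl, rfl⟩ := hd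
            exact step rfl rfl h' (by simpa using hne) (by simp)
              fun p' hp' => by simp [emb_desc, hp']
          · obtain ⟨rfl, k, rfl⟩ : e = .child ∧ ∃ k, u = List.replicate k (.child, none) := by
              by_cases hu : u = []
              · exact ⟨by cases e <;> simp_all, 0, hu⟩
              · exact anch_append_stars hq hl hu
            refine ⟨List.replicate k (.child, none) ++ (.child, some a) :: p, ?_, ?_, ?_, by simp⟩
            · simp only [refinements, refineFirst, Edge.isDesc, cond_true, List.mem_append,
                List.mem_map]
              exact .inl (.inr ⟨_, hN k (by simp), rfl⟩)
            · exact anch_replicate_append (by simpa using hp)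
            · clear hN hA hq hne h hl hd step
              induction k with
              | zero => simpa using h'
              | succ k ih => simpa [List.replicate_succ] using ih

theorem emb_canon (m : ℕ) (c : α) (p : Steps α) : emb p (wordSteps (canon m c p)) = true := by
  induction p with
  | nil => simp
  | cons s p ih =>
    have hx : ∀ x : Option α, labLe x (some (x.getD c)) = true := by rintro (_ | _) <;> simp
    obtain ⟨_ | _, x⟩ := s
    · simp [canon, Edge.isDesc, ih, hx]
    · simp only [canon, Edge.isDesc, cond_true, wordSteps_append, wordSteps_cons]
      rw [emb_desc_iff]
      exact ⟨_, _, _, _, rfl, hx x, ih⟩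

/-- A path that starts with a child edge follows the padding node by node. Since it is anchored, its
initial stars lead through child edges to a label. This label differs from `c` and is reached within
the padding because `m` exceeds the length of `r`. -/
theorem not_emb_replicate {x : Option α} {r w : Steps α} {m : ℕ} {c : α}
    (hr : anch ((.child, x) :: r) = true) (hm : r.length < m)
    (hc : ∀ e, (e, some c) ∉ (Edge.child, x) :: r) :
    emb ((.child, x) :: r) (wordSteps (List.replicate m c) ++ w) = false := by
  rw [Bool.eq_false_iff]
  intro h
  induction r generalizing x m with
  | nil =>
    cases m with
    | zero => simp at hm
    | succ m =>
      rw [List.replicate_succ, wordSteps_cons, List.cons_append, emb_child] at h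
      cases x with
      | none => simp at hr
      | some a =>
        simp at h
        exact hc .child (by simp [h])
  | cons s r ih =>
    cases m with
    | zero => simp at hm
    | succ m =>
      rw [List.replicate_succ, wordSteps_cons, List.cons_append, emb_child] at h
      cases x with
      | none =>
        obtain ⟨e, y⟩ := s
        rw [anch_none_cons] at hr
        obtain ⟨-, rfl, hr⟩ := hr
        exact ih hr (by simpa using hm) (fun e he => hc e (List.mem_cons_of_mem _ he)) h.2.2
      | some a =>
        simp at h
        exact hc .child (by simp [h.1])

/-- An anchored path that maps to the canonical word of `p`, for a label that does not occur in it
and for long inner paths, maps to `p`. -/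
theorem emb_of_emb_canon {r p : Steps α} {m : ℕ} {c : α} (hr : anch r = true)
    (hm : r.length ≤ m) (hc : ∀ e, (e, some c) ∉ r) (h : emb r (wordSteps (canon m c p)) = true) :
    emb r p = true := by
  induction r generalizing p with
  | nil => simp
  | cons s r ih =>
    have ih' : ∀ {p}, emb r (wordSteps (canon m c p)) = true → emb r p = true := fun h =>
      ih (anch_tail hr) (by simp at hm; omega) (fun e he => hc e (List.mem_cons_of_mem _ he)) h
    obtain ⟨_ | _, x⟩ := s
    · rcases p with _ | ⟨⟨_ | _, y⟩, p⟩
      · simp [canon] at h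
      · simp only [canon, Edge.isDesc, cond_false, List.nil_append, wordSteps_cons, emb_child] at h
        rw [emb_child]
        refine ⟨rfl, ?_, ih' h.2.2⟩
        cases x with
        | none => rfl
        | some a =>
          cases y with
          | none =>
            have := h.2.1
            simp at this
            -- A wildcard of `p` became `c` in the canonical word, and `c` does not occur in `r`.
            exact absurd (List.mem_cons_self ..) (this ▸ hc .child)
          | some b => exact h.2.1
      · simp only [canon, Edge.isDesc, cond_true, wordSteps_append] at h
        rw [not_emb_replicate hr (by simpa using hm) hc] at h
        simp at h
    · cases x with
      | none =>
        obtain rfl : r = [] := by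
          rcases anch_none hr with ⟨-, h⟩ | ⟨h, -⟩
          · exact h
          · simp at h
        rcases p with _ | ⟨⟨e, y⟩, p⟩
        · simp [canon] at h
        · simp [emb_desc]
      | some a =>
        have hac : a ≠ c := by
          rintro rfl
          exact hc .desc (by simp)
        -- A node labelled `a ≠ c` cannot be mapped into the padding, so the padding can be removed.
        have skip : ∀ (k : ℕ) {w}, emb ((.desc, some a) :: r)
            (wordSteps (List.replicate k c) ++ w) = true → emb ((.desc, some a) :: r) w = true := by
          intro k w h
          induction k with
          | zero => exact h
          | succ k ih =>
            rw [List.replicate_succ, wordSteps_cons, List.cons_append, emb_desc] at h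
            rcases h with h | h
            · simp at h
              exact absurd h.1.symm hac
            · exact ih h
        -- The inner induction on `p` follows the descendant edge as it skips steps of `p`; the
        -- outer hypothesis `ih'` applies once the first step has been placed.
        induction p with
        | nil => simp [canon] at h
        | cons s p ihp =>
          obtain ⟨e, y⟩ := s
          have h' : emb ((.desc, some a) :: r)
              ((.child, some (y.getD c)) :: wordSteps (canon m c p)) = true := by
            cases e
            · simpa [canon, Edge.isDesc] using h
            · simp only [canon, Edge.isDesc, cond_true, wordSteps_append] at h
              exact skip _ h
          rw [emb_desc] at h' ⊢
          refine h'.imp (fun h => ⟨?_, ih' h.2⟩) ihp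
          cases y with
          | none => exact absurd (by simpa using h.1) (Ne.symm hac)
          | some b => exact h.1

end combinatorics

/-! ### Languages of twig and path queries -/

section languages

variable {α : Type u}

theorem LTree.induction {P : LTree α → Prop}
    (h : ∀ a ts, (∀ t ∈ ts, P t) → P (.node a ts)) : ∀ t, P t
  | .node a ts => h a ts fun t _ => LTree.induction h t

theorem LTree.sub_append (t : LTree α) (p q : List ℕ) :
    t.sub (p ++ q) = (t.sub p).bind fun t' => t'.sub q := by
  induction p generalizing t with
  | nil => simp [LTree.sub]
  | cons i p ih =>
    obtain ⟨a, ts⟩ := t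
    simp only [List.cons_append, LTree.sub]
    cases ts[i]? <;> simp [ih]

theorem Twig.sub_append (t : Twig α) (p q : List ℕ) :
    t.sub (p ++ q) = (t.sub p).bind fun t' => t'.sub q := by
  induction p generalizing t with
  | nil => simp [Twig.sub]
  | cons i p ih =>
    obtain ⟨a, ts⟩ := t
    simp only [List.cons_append, Twig.sub]
    cases ts[i]? <;> simp [ih]

theorem Twig.sub_singleton (q : Twig α) (i : ℕ) :
    q.sub [i] = (q.children[i]?).map Prod.snd := by
  obtain ⟨a, qs⟩ := q
  simp only [Twig.sub, Twig.children]
  cases qs[i]? <;> simp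

/-- The address `d` leads from a node to one to which an edge of kind `e` may be mapped. -/
def EdgeOk (e : Edge) (d : List ℕ) : Prop := d ≠ [] ∧ (e = .child → d.length = 1)

theorem LTree.transGen_child {t : LTree α} (n n' : t.Node) :
    Relation.TransGen t.Child n n' ↔ ∃ d, d ≠ [] ∧ n'.1 = n.1 ++ d := by
  constructor
  · intro h
    induction h with
    | single h => obtain ⟨i, h⟩ := h; exact ⟨[i], by simp, h⟩
    | tail _ h ih =>
      obtain ⟨i, h⟩ := h
      obtain ⟨d, hd, h'⟩ := ih
      exact ⟨d ++ [i], by simp, by rw [h, h', List.append_assoc]⟩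
  · rintro ⟨d, hd, h⟩
    induction d using List.reverseRecOn generalizing n' with
    | nil => exact absurd rfl hd
    | append_singleton d i ih =>
      by_cases hd' : d = []
      · subst hd'
        exact .single ⟨i, h⟩
      · have hs : (t.sub (n.1 ++ d)).isSome := by
          have := n'.2
          rw [h, ← List.append_assoc, LTree.sub_append] at this
          cases hx : t.sub (n.1 ++ d) <;> simp_all
        exact .tail (ih ⟨n.1 ++ d, hs⟩ hd' rfl) ⟨i, by rw [h, List.append_assoc]⟩

/-- Embeddings in terms of addresses. -/
theorem Twig.mem_lang_iff (q : Twig α) (t : LTree α) :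
    t ∈ q.lang ↔ ∃ g : List ℕ → List ℕ, g [] = [] ∧ ∀ n r, q.sub n = some r →
      ∃ t', t.sub (g n) = some t' ∧ (∀ a, r.label = some a → t'.label = a) ∧
        ∀ (i : ℕ) e r', r.children[i]? = some (e, r') →
          ∃ d, g (n ++ [i]) = g n ++ d ∧ EdgeOk e d := by
  constructor
  · rintro ⟨f, hf⟩
    have hg : ∀ n (h : (q.sub n).isSome),
        (if h : (q.sub n).isSome then (f ⟨n, h⟩).1 else []) = (f ⟨n, h⟩).1 := fun n h => dif_pos h
    -- Outside the nodes of `q` the value is arbitrary; `[]` is a dummy.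
    refine ⟨fun n => if h : (q.sub n).isSome then (f ⟨n, h⟩).1 else [], ?_, fun n r hr => ?_⟩
    · exact (hg [] q.root.2).trans (congrArg Subtype.val hf.root)
    · have hn : (q.sub n).isSome := by simp [hr]
      have hget : (q.sub n).get hn = r := by simp [hr]
      refine ⟨(t.sub (f ⟨n, hn⟩).1).get (f ⟨n, hn⟩).2, by simp [hg n hn], fun a ha => ?_,
        fun i e r' hi => ?_⟩
      · exact hf.lab ⟨n, hn⟩ a (show ((q.sub n).get hn).label = some a by rw [hget, ha])
      · have hn' : (q.sub (n ++ [i])).isSome := by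
          rw [Twig.sub_append, hr]
          simp [Twig.sub_singleton, hi]
        have he : q.HasEdge e ⟨n, hn⟩ ⟨n ++ [i], hn'⟩ := ⟨i, r', by rw [hget, hi], rfl⟩
        beta_reduce
        rw [hg n hn, hg _ hn']
        cases e with
        | child =>
          obtain ⟨j, hj⟩ := hf.child _ _ he
          exact ⟨[j], hj, by simp, by simp⟩
        | desc =>
          obtain ⟨d, hd, h⟩ := (LTree.transGen_child _ _).1 (hf.desc _ _ he)
          exact ⟨d, h, hd, by simp⟩
  · rintro ⟨g, hg₀, hg⟩
    have hs : ∀ n : q.Node, (t.sub (g n.1)).isSome := by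
      intro n
      obtain ⟨t', h, -⟩ := hg n.1 _ (Option.some_get n.2).symm
      simp [h]
    have hedge : ∀ e (n n' : q.Node), q.HasEdge e n n' →
        ∃ d, g n'.1 = g n.1 ++ d ∧ EdgeOk e d := by
      rintro e n n' ⟨i, r, hi, hn'⟩
      obtain ⟨t', -, -, h⟩ := hg n.1 _ (Option.some_get n.2).symm
      rw [hn']
      exact h i e r hi
    refine ⟨fun n => ⟨g n.1, hs n⟩, Subtype.ext hg₀, fun n n' h => ?_, fun n n' h => ?_,
      fun n a ha => ?_⟩
    · obtain ⟨d, h, -, hd⟩ := hedge _ _ _ h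
      obtain ⟨j, rfl⟩ := List.length_eq_one_iff.1 (hd rfl)
      exact ⟨j, h⟩
    · obtain ⟨d, h, hd, -⟩ := hedge _ _ _ h
      exact (LTree.transGen_child _ _).2 ⟨d, hd, h⟩
    · obtain ⟨t', h, hl, -⟩ := hg n.1 _ (Option.some_get n.2).symm
      have := hl a ha
      simp [LTree.lab, h, this]

/-- Embeddings need not be injective, so the branches below a root are embedded independently of
each other. -/
theorem Twig.mem_lang_node (x : Option α) (qs : List (Edge × Twig α)) (t : LTree α) :
    t ∈ (Twig.node x qs).lang ↔ (∀ a, x = some a → t.label = a) ∧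
      ∀ s ∈ qs, ∃ d t', EdgeOk s.1 d ∧ t.sub d = some t' ∧ t' ∈ s.2.lang := by
  constructor
  · intro ht
    obtain ⟨g, hg₀, hg⟩ := (Twig.mem_lang_iff _ _).1 ht
    obtain ⟨t₀, ht₀, hlab, hedge⟩ := hg [] _ rfl
    obtain rfl : t = t₀ := by simpa [hg₀, LTree.sub] using ht₀
    refine ⟨hlab, fun s hs => ?_⟩
    obtain ⟨e, q⟩ := s
    obtain ⟨i, hi⟩ := List.mem_iff_getElem?.1 hs
    have hsub : ∀ m, (Twig.node x qs).sub (i :: m) = q.sub m := by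
      intro m; simp [Twig.sub, hi]
    obtain ⟨d, hd, hok⟩ := hedge i e q hi
    rw [hg₀, List.nil_append, List.nil_append] at hd
    -- The whole branch is mapped below the image `d` of its root, so that the prefix `d` can be
    -- stripped from all addresses.
    have hpre : ∀ m, (q.sub m).isSome → ∃ r, g (i :: m) = d ++ r := by
      intro m
      induction m using List.reverseRecOn with
      | nil => exact fun _ => ⟨[], by simpa using hd⟩
      | append_singleton m j ih =>
        intro h
        rw [Twig.sub_append] at h
        cases hm : q.sub m with
        | none => simp [hm] at h
        | some r =>
          obtain ⟨u, hu⟩ := ih (by simp [hm])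
          obtain ⟨-, -, -, h'⟩ := hg (i :: m) r (by rw [hsub, hm])
          simp only [hm, Option.bind_some, Twig.sub_singleton, Option.isSome_map] at h
          obtain ⟨⟨e', r'⟩, hr'⟩ := Option.isSome_iff_exists.1 h
          obtain ⟨d', hd', -⟩ := h' j e' r' hr'
          exact ⟨u ++ d', by simpa [hu] using hd'⟩
    obtain ⟨t', ht', -⟩ := hg [i] q (by rw [hsub]; rfl)
    rw [hd] at ht'
    refine ⟨d, t', hok, ht', (Twig.mem_lang_iff _ _).2
      ⟨fun m => (g (i :: m)).drop d.length, by simp [hd], fun m r hr => ?_⟩⟩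
    obtain ⟨u, hu⟩ := hpre m (by simp [hr])
    obtain ⟨t'', ht'', hl, he⟩ := hg (i :: m) r (by rw [hsub, hr])
    refine ⟨t'', ?_, hl, fun j e' r' hj => ?_⟩
    · rw [hu, LTree.sub_append, ht'] at ht''
      simpa [hu] using ht''
    · obtain ⟨d', hd', hok'⟩ := he j e' r' hj
      refine ⟨d', ?_, hok'⟩
      rw [List.cons_append, hu, List.append_assoc] at hd'
      simp [hu, hd']
  · rintro ⟨hlab, h⟩
    -- Indices without a branch receive dummy data, which lets `choose` produce total functions.
    have h' : ∀ i : ℕ, ∃ (d : List ℕ) (g : List ℕ → List ℕ), g [] = [] ∧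
        ∀ e q, qs[i]? = some (e, q) → ∃ t', EdgeOk e d ∧ t.sub d = some t' ∧
          ∀ n r, q.sub n = some r →
      ∃ t'', t'.sub (g n) = some t'' ∧ (∀ a, r.label = some a → t''.label = a) ∧
        ∀ (i : ℕ) e r', r.children[i]? = some (e, r') →
          ∃ d, g (n ++ [i]) = g n ++ d ∧ EdgeOk e d := by
      intro i
      cases hi : qs[i]? with
      | none => exact ⟨[], fun _ => [], rfl, by simp⟩
      | some s =>
        obtain ⟨d, t', hok, ht', hm⟩ := h s (List.mem_of_getElem? hi)
        obtain ⟨g, hg₀, hg⟩ := (Twig.mem_lang_iff _ _).1 hm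
        refine ⟨d, g, hg₀, fun e q hs => ?_⟩
        obtain rfl := Option.some.inj hs
        exact ⟨t', hok, ht', hg⟩
    choose d g hg₀ hg using h'
    refine (Twig.mem_lang_iff _ _).2
      ⟨fun n => match n with | [] => [] | i :: m => d i ++ g i m, rfl, fun n r hr => ?_⟩
    cases n with
    | nil =>
      obtain rfl := Option.some.inj hr
      refine ⟨t, rfl, hlab, fun i e r' hi => ?_⟩
      obtain ⟨t', hok, -⟩ := hg i e r' hi
      exact ⟨d i, by simp [hg₀], hok⟩
    | cons i m =>
      simp only [Twig.sub] at hr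
      cases hi : qs[i]? with
      | none => simp [hi] at hr
      | some s =>
        obtain ⟨e, q⟩ := s
        rw [hi] at hr
        obtain ⟨t', -, ht', hm⟩ := hg i e q hi
        obtain ⟨t'', h₁, h₂, h₃⟩ := hm m r hr
        refine ⟨t'', by simp [LTree.sub_append, ht', h₁], h₂, fun j e' r' hj => ?_⟩
        obtain ⟨d', hd', hok⟩ := h₃ j e' r' hj
        exact ⟨d', by simp [hd'], hok⟩

/-- `w` is the sequence of labels on a path from the root of a tree, without the root. -/
def IsPath : LTree α → List α → Prop
  | _, [] => True
  | t, a :: w => ∃ t' ∈ t.children, t'.label = a ∧ IsPath t' w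
termination_by structural _ w => w

theorem isPath_of_append {t : LTree α} {w w' : List α} (h : IsPath t (w ++ w')) : IsPath t w := by
  induction w generalizing t with
  | nil => simp [IsPath]
  | cons a w ih =>
    obtain ⟨t', h₁, h₂, h₃⟩ := h
    exact ⟨t', h₁, h₂, ih h₃⟩

theorem IsPath.take {t : LTree α} {w : List α} (h : IsPath t w) (n : ℕ) : IsPath t (w.take n) :=
  isPath_of_append (w' := w.drop n) (by rwa [List.take_append_drop])

theorem isPath_of_sub {t t' : LTree α} {d : List ℕ} {w : List α} (h : t.sub d = some t')
    (hd : d ≠ []) (hw : IsPath t' w) :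
    ∃ u, u.length + 1 = d.length ∧ IsPath t (u ++ t'.label :: w) := by
  induction d generalizing t with
  | nil => exact absurd rfl hd
  | cons i d ih =>
    obtain ⟨a, ts⟩ := t
    simp only [LTree.sub] at h
    cases hi : ts[i]? with
    | none => simp [hi] at h
    | some s =>
      rw [hi] at h
      by_cases hd' : d = []
      · subst hd'
        obtain rfl : s = t' := by simpa [LTree.sub] using h
        exact ⟨[], rfl, s, List.mem_of_getElem? hi, rfl, hw⟩
      · obtain ⟨u, hu, hp⟩ := ih h hd'
        exact ⟨s.label :: u, by simp [← hu], s, List.mem_of_getElem? hi, rfl, hp⟩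

theorem exists_sub_of_isPath {t : LTree α} {u w : List α} {b : α} (h : IsPath t (u ++ b :: w)) :
    ∃ d t', d.length = u.length + 1 ∧ t.sub d = some t' ∧ t'.label = b ∧ IsPath t' w := by
  induction u generalizing t with
  | nil =>
    obtain ⟨t', h₁, h₂, h₃⟩ := h
    obtain ⟨i, hi⟩ := List.mem_iff_getElem?.1 h₁
    obtain ⟨a, ts⟩ := t
    exact ⟨[i], t', rfl, by simp only [LTree.children] at hi; simp [LTree.sub, hi], h₂, h₃⟩
  | cons c u ih =>
    obtain ⟨s, h₁, h₂, h₃⟩ := h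
    obtain ⟨i, hi⟩ := List.mem_iff_getElem?.1 h₁
    obtain ⟨a, ts⟩ := t
    obtain ⟨d, t', hd, h₄, h₅⟩ := ih h₃
    exact ⟨i :: d, t', by simp [hd], by simp only [LTree.children] at hi; simp [LTree.sub, hi, h₄],
      h₅⟩

variable [DecidableEq α]

/-- A path query uses a single downward path of the tree: the embedding of the rest of the query is
extended by the labels on the way to the image of its first node. -/
theorem mem_branch_iff (s : Steps α) (t : LTree α) :
    (∀ b ∈ PathQuery.branch s, ∃ d t', EdgeOk b.1 d ∧ t.sub d = some t' ∧ t' ∈ b.2.lang) ↔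
      ∃ w, IsPath t w ∧ emb s (wordSteps w) = true := by
  induction s generalizing t with
  | nil => simpa [PathQuery.branch] using ⟨[], trivial⟩
  | cons s p ih =>
    obtain ⟨e, x⟩ := s
    simp only [PathQuery.branch, List.mem_singleton, forall_eq, Twig.mem_lang_node, ih]
    constructor
    · rintro ⟨d, t', hok, ht', hx, w, hw, he⟩
      obtain ⟨u, hu, hp⟩ := isPath_of_sub ht' hok.1 hw
      refine ⟨_, hp, ?_⟩
      have hx' : labLe x (some t'.label) = true := by
        cases x with
        | none => rfl
        | some a => simp [hx a rfl]
      cases e with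
      | child =>
        have := hok.2 rfl
        obtain rfl : u = [] := List.length_eq_zero_iff.1 (by omega)
        simpa using ⟨hx', he⟩
      | desc =>
        rw [wordSteps_append, emb_desc_iff]
        exact ⟨_, _, _, _, rfl, hx', he⟩
    · have key : ∀ u b w, IsPath t (u ++ b :: w) → labLe x (some b) = true →
          emb p (wordSteps w) = true → (e = .child → u = []) →
          ∃ d t', EdgeOk e d ∧ t.sub d = some t' ∧ (∀ a, x = some a → t'.label = a) ∧
            ∃ w, IsPath t' w ∧ emb p (wordSteps w) = true := by
        intro u b w hp hx he hu
        obtain ⟨d, t', hd, ht', rfl, hw⟩ := exists_sub_of_isPath hp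
        refine ⟨d, t', ⟨by rintro rfl; simp at hd, fun h => by simp [hd, hu h]⟩, ht',
          fun a ha => ?_, w, hw, he⟩
        subst ha
        simpa using hx
      rintro ⟨w, hw, he⟩
      cases e with
      | child =>
        cases w with
        | nil => simp at he
        | cons b w =>
          rw [wordSteps_cons, emb_child] at he
          exact key [] b w hw he.2.1 he.2.2 fun _ => rfl
      | desc =>
        obtain ⟨u', e', y, q', hw', hx, he⟩ := (emb_desc_iff _ _ _).1 he
        obtain ⟨u, v, rfl, -, hv⟩ := List.map_eq_append_iff.1 hw'
        obtain ⟨b, w, rfl, hb, rfl⟩ := List.map_eq_cons_iff.1 hv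
        obtain ⟨rfl, rfl⟩ := Prod.mk.injEq .. ▸ hb
        exact key u b w hw hx he (by simp)

theorem PathQuery.mem_lang_iff (p : PathQuery α) (t : LTree α) :
    t ∈ p.lang ↔ (∀ a, p.head = some a → t.label = a) ∧
      ∃ w, IsPath t w ∧ emb p.steps (wordSteps w) = true := by
  rw [PathQuery.lang, PathQuery.toTwig, Twig.mem_lang_node, mem_branch_iff]

omit [DecidableEq α] in
-- Head-consistency makes the arbitrarily chosen root label of the glued query the label of every
-- path in it.
theorem ConjPath.mem_lang_iff (P : ConjPath α) (t : LTree α) :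
    t ∈ P.toTwig.lang ↔ ∀ p ∈ P.paths, t ∈ p.lang := by
  have hc : ∀ p ∈ P.paths, P.nonempty.choose.head = p.head := fun p hp =>
    P.headConsistent _ P.nonempty.choose_spec _ hp
  simp only [ConjPath.toTwig, Twig.mem_lang_node, List.mem_flatMap, Finset.mem_toList,
    PathQuery.lang, PathQuery.toTwig]
  constructor
  · rintro ⟨h₁, h₂⟩ p hp
    exact ⟨hc p hp ▸ h₁, fun s hs => h₂ s ⟨p, hp, hs⟩⟩
  · intro h
    exact ⟨(h _ P.nonempty.choose_spec).1, fun s ⟨p, hp, hs⟩ => (h p hp).2 s hs⟩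

/-! ### Anchored paths -/

omit [DecidableEq α] in
theorem PathQuery.isStar_cons (x y : Option α) (e : Edge) (p : Steps α) (i : ℕ) :
    PathQuery.IsStar ⟨x, (e, y) :: p⟩ (i + 1) ↔ PathQuery.IsStar ⟨y, p⟩ i := by
  simp [PathQuery.IsStar]

omit [DecidableEq α] in
theorem PathQuery.isDesc_cons (x y : Option α) (e : Edge) (p : Steps α) (i : ℕ) :
    PathQuery.IsDesc ⟨x, (e, y) :: p⟩ (i + 1) ↔ PathQuery.IsDesc ⟨y, p⟩ i := by
  simp [PathQuery.IsDesc]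

omit [DecidableEq α] in
-- Dropping the first step turns the next node into a root, which is exempt from the conditions on
-- stars. The second conjunct restores them for this node.
theorem PathQuery.anchored_cons (x y : Option α) (e : Edge) (p : Steps α) :
    PathQuery.Anchored ⟨x, (e, y) :: p⟩ ↔ PathQuery.Anchored ⟨y, p⟩ ∧
      (y.isSome ∨ match p with | [] => e = .desc | s :: _ => e = .child ∧ s.1 = .child) := by
  have h₀ : ∀ i, PathQuery.IsStar ⟨x, (e, y) :: p⟩ (i + 1) ↔ PathQuery.IsStar ⟨y, p⟩ i :=
    PathQuery.isStar_cons x y e p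
  have h₁ : ∀ i, PathQuery.IsDesc ⟨x, (e, y) :: p⟩ (i + 1) ↔ PathQuery.IsDesc ⟨y, p⟩ i :=
    PathQuery.isDesc_cons x y e p
  have h₂ : PathQuery.IsDesc ⟨x, (e, y) :: p⟩ 0 ↔ e = .desc := by simp [PathQuery.IsDesc]
  have h₃ : PathQuery.IsStar ⟨y, p⟩ 0 ↔ y = none := by simp [PathQuery.IsStar]
  constructor
  · intro h
    refine ⟨⟨fun i hd hs => ?_, fun i hd hs => ?_, fun i hi hs => ?_⟩, ?_⟩
    · exact absurd (h.upper (i + 1) ((h₁ i).2 hd) ((h₀ i).2 hs)) (by simp)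
    · simpa using h.lower (i + 1) ((h₁ i).2 hd) ((h₀ (i + 1)).2 hs)
    · exact (h₁ i).1 (h.leaf (i + 1) (by simpa using hi) ((h₀ (i + 1)).2 hs))
    · cases y with
      | some a => simp
      | none =>
        right
        have hs := (h₀ 0).2 (h₃.2 rfl)
        rcases p with _ | ⟨⟨e', y'⟩, p⟩
        · exact h₂.1 (h.leaf 0 rfl hs)
        · constructor
          · cases e with
            | child => rfl
            | desc => simpa using h.lower 0 (h₂.2 rfl) hs
          · cases e' with
            | child => rfl
            | desc => simpa using h.upper 1 ((h₁ 0).2 (by simp [PathQuery.IsDesc])) hs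
  · rintro ⟨h, hy⟩
    refine ⟨fun i hd hs => ?_, fun i hd hs => ?_, fun i hi hs => ?_⟩
    · rcases i with _ | i
      · rfl
      · have hd' := (h₁ i).1 hd
        have hs' := (h₀ i).1 hs
        obtain rfl := h.upper i hd' hs'
        rw [h₃] at hs'
        subst hs'
        rcases p with _ | ⟨⟨e', y'⟩, p⟩
        · simp [PathQuery.IsDesc] at hd'
        · simp [PathQuery.IsDesc] at hd'
          simp [hd'] at hy
    · rcases i with _ | i
      · have hs' := (h₀ 0).1 hs
        rw [h₃] at hs'
        rw [h₂] at hd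
        subst hs' hd
        rcases p with _ | ⟨s, p⟩
        · rfl
        · simp at hy
      · simpa using h.lower i ((h₁ i).1 hd) ((h₀ (i + 1)).1 hs)
    · rcases i with _ | i
      · have hs' := (h₀ 0).1 hs
        rw [h₃] at hs'
        rcases p with _ | ⟨s, p⟩
        · rw [h₂]
          simpa [hs'] using hy
        · simp at hi
      · exact (h₁ i).2 (h.leaf i (by simpa using hi) ((h₀ (i + 1)).1 hs))

omit [DecidableEq α] in
theorem PathQuery.anchored_iff (x : Option α) (p : Steps α) :
    PathQuery.Anchored ⟨x, p⟩ ↔ anch p = true := by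
  induction p generalizing x with
  | nil =>
    refine ⟨fun _ => rfl, fun _ => ⟨?_, ?_, ?_⟩⟩ <;> simp [PathQuery.IsDesc]
  | cons s p ih =>
    obtain ⟨e, y⟩ := s
    rw [PathQuery.anchored_cons, ih, and_comm]
    cases p <;> simp [anch]

/-! ### Isomorphic trees -/

omit [DecidableEq α]

theorem LTree.Iso.symm {t t' : LTree α} (h : t.Iso t') : t'.Iso t := by
  obtain ⟨e, h₁, h₂, h₃⟩ := h
  refine ⟨e.symm, by rw [← h₁, e.symm_apply_apply], fun n n' => ?_, fun n => ?_⟩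
  · rw [h₂, e.apply_symm_apply, e.apply_symm_apply]
  · rw [h₃, e.apply_symm_apply]

theorem LTree.Iso.mem_lang {t t' : LTree α} (h : t.Iso t') {q : Twig α} (ht : t ∈ q.lang) :
    t' ∈ q.lang := by
  obtain ⟨e, h₁, h₂, h₃⟩ := h
  obtain ⟨f, hf⟩ := ht
  refine ⟨fun n => e (f n), by rw [hf.root, h₁], fun n n' hn => (h₂ _ _).1 (hf.child n n' hn),
    fun n n' hn => (hf.desc n n' hn).lift e fun a b => (h₂ a b).1, fun n a ha => ?_⟩
  rw [← h₃, hf.lab n a ha]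

theorem LTree.sizeList_eq (ts : List (LTree α)) : sizeList ts = (ts.map size).sum := by
  induction ts with
  | nil => rfl
  | cons t ts ih => simp [sizeList, ih]

/-- The nodes of a tree are its root and the nodes of its immediate subtrees. -/
def LTree.nodeEquiv (a : α) (ts : List (LTree α)) :
    (LTree.node a ts).Node ≃ Option (Σ i : Fin ts.length, (ts.get i).Node) where
  toFun n := match n with
    | ⟨[], _⟩ => none
    | ⟨i :: p, h⟩ =>
      have hi : i < ts.length := by
        by_contra hi
        simp [LTree.sub, List.getElem?_eq_none (not_lt.1 hi)] at h
      some ⟨⟨i, hi⟩, p, by simpa [LTree.sub, List.getElem?_eq_getElem hi] using h⟩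
  invFun o := match o with
    | none => ⟨[], rfl⟩
    | some ⟨i, p, h⟩ => ⟨i :: p, by simpa [LTree.sub] using h⟩
  left_inv := by rintro ⟨_ | ⟨i, p⟩, h⟩ <;> rfl
  right_inv := by rintro (_ | ⟨i, p, h⟩) <;> rfl

/-- This makes the size an invariant of isomorphism. -/
theorem LTree.card_node (t : LTree α) : Finite t.Node ∧ Nat.card t.Node = t.size := by
  induction t using LTree.induction with
  | h a ts ih =>
    have h₁ : ∀ i : Fin ts.length, Finite (ts.get i).Node := fun i => (ih _ (ts.get_mem i)).1
    refine ⟨.of_equiv _ (nodeEquiv a ts).symm, ?_⟩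
    rw [Nat.card_congr (nodeEquiv a ts), Finite.card_option, Nat.card_sigma, size, sizeList_eq,
      add_comm, Finset.sum_congr rfl fun i _ => (ih _ (ts.get_mem i)).2]
    congr 1
    rw [← Fin.sum_univ_getElem (ts.map size)]
    exact (Fintype.sum_equiv (finCongr (by simp)) _ _ (by simp))

theorem LTree.Iso.size_eq {t t' : LTree α} (h : t.Iso t') : t.size = t'.size := by
  obtain ⟨e, -⟩ := h
  rw [← t.card_node.2, ← t'.card_node.2, Nat.card_congr e]

/-! ### Trees with prescribed paths -/

/-- The tree without branching, below a root, with the given labels. -/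
def chain : List α → List (LTree α)
  | [] => []
  | a :: w => [.node a (chain w)]

/-- The tree obtained by gluing paths together at their roots. -/
def glue (a : α) (ws : List (List α)) : LTree α := .node a (ws.flatMap chain)

theorem isPath_chain (a : α) (v w : List α) : IsPath (.node a (chain v)) w ↔ w <+: v := by
  induction w generalizing a v with
  | nil => simp [IsPath]
  | cons b w ih =>
    cases v with
    | nil => simp [IsPath, LTree.children, chain]
    | cons c v =>
      simp [IsPath, LTree.children, chain, ih, LTree.label, List.cons_prefix_cons, eq_comm]

theorem isPath_glue (a : α) (ws : List (List α)) (w : List α) :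
    IsPath (glue a ws) w ↔ w = [] ∨ ∃ v ∈ ws, w <+: v := by
  cases w with
  | nil => simp [IsPath]
  | cons b w =>
    simp only [reduceCtorEq, false_or, ← isPath_chain a]
    simp only [IsPath, glue, LTree.children, List.mem_flatMap]
    constructor
    · rintro ⟨t, ⟨v, hv, ht⟩, h⟩
      exact ⟨v, hv, t, ht, h⟩
    · rintro ⟨v, hv, t, ht, h⟩
      exact ⟨t, ⟨v, hv, ht⟩, h⟩

theorem size_glue (a : α) (ws : List (List α)) :
    (glue a ws).size = 1 + (ws.map List.length).sum := by
  have h : ∀ v : List α, ((chain v).map LTree.size).sum = v.length := by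
    intro v
    induction v with
    | nil => rfl
    | cons b v ih => simp [chain, LTree.size, LTree.sizeList_eq, ih, add_comm]
  rw [glue, LTree.size, LTree.sizeList_eq]
  congr 1
  induction ws with
  | nil => rfl
  | cons v ws ih => simp [List.flatMap_cons, h, ih]

/-- Isomorphic trees have the same paths. -/
theorem LTree.Iso.isPath [DecidableEq α] {t t' : LTree α} (h : t.Iso t') {w : List α}
    (hw : IsPath t w) : IsPath t' w := by
  -- The word is itself a path query, and languages are closed under isomorphism. A homomorphism
  -- between words with child edges only is a prefix relation.
  have h₁ : t ∈ (PathQuery.mk none (wordSteps w)).lang :=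
    (PathQuery.mem_lang_iff _ _).2 ⟨by simp, w, hw, emb_refl _⟩
  obtain ⟨-, v, hv, he⟩ := (PathQuery.mem_lang_iff _ _).1 (h.mem_lang h₁)
  obtain ⟨u, rfl⟩ : w <+: v := by
    clear hw hv h h₁
    replace he : emb (wordSteps w) (wordSteps v) = true := he
    induction w generalizing v with
    | nil => simp
    | cons a w ih =>
      cases v with
      | nil => simp at he
      | cons b v =>
        simp only [wordSteps_cons, emb_child, labLe_some, Option.some.injEq] at he
        rw [List.cons_prefix_cons]
        exact ⟨he.2.1.symm, ih v he.2.2⟩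
  exact isPath_of_append hv

theorem LTree.Iso.label_eq {t t' : LTree α} (h : t.Iso t') : t.label = t'.label := by
  obtain ⟨e, h₁, -, h₃⟩ := h
  have := h₃ t.root
  rw [h₁] at this
  exact this

end languages

/-! ### The learning algorithm -/

section algorithm

variable {α : Type u}

/-- The immediate subtrees of the first tree on the stack are put on the stack, together with the
paths that lead to them, and the path to that tree is put out. -/
def wordStep : List (Steps α × LTree α) × List (Steps α) →
    List (Steps α × LTree α) × List (Steps α)
  | ([], out) => ([], out)
  | (x :: st, out) =>
    (x.2.children.map (fun t => (x.1 ++ [(.child, some t.label)], t)) ++ st, x.1 :: out)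

/-- The paths from the root of a tree to its nodes. -/
def treeWords (t : LTree α) : List (Steps α) := (wordStep^[t.size] ([([], t)], [])).2

/-- The total size of the trees on the stack. -/
def stackSize (st : List (Steps α × LTree α)) : ℕ := (st.map fun x => x.2.size).sum

theorem LTree.size_eq (t : LTree α) : t.size = 1 + (t.children.map LTree.size).sum := by
  obtain ⟨a, ts⟩ := t
  rw [LTree.size, LTree.sizeList_eq, LTree.children]

/-- Replacing a tree by its children removes one node, so `t.size` rounds empty the stack. Truncated
subtraction covers the empty stack. -/
theorem stackSize_wordStep (s : List (Steps α × LTree α) × List (Steps α)) :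
    stackSize (wordStep s).1 = stackSize s.1 - 1 := by
  obtain ⟨_ | ⟨x, st⟩, out⟩ := s
  · rfl
  · have h := x.2.size_eq
    have h' : (x.2.children.map ((fun x : Steps α × LTree α => x.2.size) ∘
        fun t => (x.1 ++ [(.child, some t.label)], t))) = x.2.children.map LTree.size := rfl
    simp only [wordStep, stackSize, List.map_append, List.sum_append, List.map_map, List.map_cons,
      List.sum_cons, h']
    omega

theorem stackSize_iterate (t : LTree α) (i : ℕ) :
    stackSize (wordStep^[i] ([([], t)], [])).1 = t.size - i := by
  induction i with
  | zero => simp [stackSize]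
  | succ i ih => rw [Function.iterate_succ_apply', stackSize_wordStep, ih]; omega

theorem stackSize_eq_zero {st : List (Steps α × LTree α)} : stackSize st = 0 ↔ st = [] := by
  cases st with
  | nil => simp [stackSize]
  | cons x st => have := x.2.size_eq; simp [stackSize]; omega

theorem mem_treeWords {t : LTree α} {u : Steps α} :
    u ∈ treeWords t ↔ ∃ w, IsPath t w ∧ u = wordSteps w := by
  -- Loop invariant: `u` has been put out or is still to come from an entry of the stack.
  let D : List (Steps α × LTree α) × List (Steps α) → Prop := fun s =>
    u ∈ s.2 ∨ ∃ x ∈ s.1, ∃ w, IsPath x.2 w ∧ u = x.1 ++ wordSteps w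
  have hD : ∀ s, D (wordStep s) ↔ D s := by
    rintro ⟨_ | ⟨x, st⟩, out⟩
    · rfl
    · have hx : (∃ w, IsPath x.2 w ∧ u = x.1 ++ wordSteps w) ↔ u = x.1 ∨
          ∃ t ∈ x.2.children, ∃ w, IsPath t w ∧
            u = x.1 ++ [(.child, some t.label)] ++ wordSteps w := by
        constructor
        · rintro ⟨_ | ⟨a, w⟩, h, rfl⟩
          · simp
          · obtain ⟨t, ht, rfl, h⟩ := h
            exact .inr ⟨t, ht, w, h, by simp⟩
        · rintro (rfl | ⟨t, ht, w, h, rfl⟩)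
          · exact ⟨[], trivial, by simp⟩
          · exact ⟨t.label :: w, ⟨t, ht, rfl, h⟩, by simp⟩
      simp only [D, wordStep, List.mem_cons, List.mem_append, List.mem_map, or_and_right, exists_or,
        exists_eq_left, hx, exists_exists_and_eq_and]
      rw [or_comm (a := u = x.1) (b := u ∈ out)]
      simp only [or_assoc]
  have hi : ∀ i s, D (wordStep^[i] s) ↔ D s := by
    intro i s
    induction i with
    | zero => rfl
    | succ i ih => rw [Function.iterate_succ_apply', hD, ih]
  have h₀ : (wordStep^[t.size] ([([], t)], [])).1 = [] := by
    rw [← stackSize_eq_zero, stackSize_iterate]; omega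
  have := hi t.size ([([], t)], [])
  simpa [D, h₀, treeWords] using this

variable [DecidableEq α]

/-- The table of `emb p w` for all nonempty suffixes `p` of a path. -/
def embTable : Steps α → Steps α → List ((Edge × Option α) × Bool)
  | [], _ => []
  | s :: p, w => (s, emb (s :: p) w) :: embTable p w

/-- The first value in a table. -/
def tableHead (row : List ((Edge × Option α) × Bool)) : Bool :=
  match row with
  | [] => true
  | s :: _ => s.2

theorem tableHead_embTable (p w : Steps α) : tableHead (embTable p w) = emb p w := by
  cases p <;> simp [embTable, tableHead]

/-- The table for `y :: w` from the table for `w`, of which the first value is also returned. -/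
def embRow (y : Edge × Option α) (row : List ((Edge × Option α) × Bool)) :
    Bool × List ((Edge × Option α) × Bool) :=
  row.foldr (fun s acc => (s.2, (s.1,
    bif s.1.1.isDesc then labLe s.1.2 y.2 && acc.1 || s.2
    else !y.1.isDesc && (labLe s.1.2 y.2 && acc.1)) :: acc.2)) (true, [])

/-- The fold from the right passes on the old entry of each suffix, which is the value `emb p w`
needed by the next entry to the left. -/
theorem embRow_embTable (y : Edge × Option α) (p w : Steps α) :
    embRow y (embTable p w) = (emb p w, embTable p (y :: w)) := by
  induction p with
  | nil => simp [embTable, embRow]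
  | cons s p ih =>
    obtain ⟨_ | _, x⟩ := s <;> rw [embTable, embTable, embRow, List.foldr_cons, ← embRow, ih] <;>
      simp [emb, Edge.isDesc]

/-- The direct recursion for `emb` branches at descendant edges and may take exponential time.
Building the table one letter of `w` at a time is dynamic programming. -/
theorem embTable_eq_foldr (p w : Steps α) :
    embTable p w = w.foldr (fun y row => (embRow y row).2) (p.map fun s => (s, false)) := by
  induction w with
  | nil =>
    induction p with
    | nil => rfl
    | cons s p ih => simp [embTable, ih]
  | cons y w ih => rw [List.foldr_cons, ← ih, embRow_embTable]

/-- Every list in `C` contains a word that the path `p` matches. -/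
def consistent (C : List (List (Steps α))) (p : Steps α) : Bool := C.all fun W => W.any (emb p)

/-- The labels that occur in `C`. -/
def labelsOf (C : List (List (Steps α))) : List α :=
  C.flatten.flatten.flatMap fun s => s.2.toList

/-- The sequences of stars as long as a word in `C`. -/
def starsOf (C : List (List (Steps α))) : List (Steps α) :=
  C.flatten.map fun w => w.map fun _ => (.child, none)

/-- The first anchored elementary refinement of `p` that is consistent with `C`, if there is any,
and else `p` itself. -/
def refine (C : List (List (Steps α))) (p : Steps α) : Steps α :=
  ((refinements (labelsOf C) (starsOf C) p).filter fun p' => anch p' && consistent C p').headD p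

/-- A path that is consistent with `C` and cannot be refined. -/
def greedy (C : List (List (Steps α))) : Steps α :=
  -- The list serves only as a counter. A path that maps to a word is no longer than it and has
  -- measure at most three times its own length, so three times the total length of all words is
  -- enough rounds.
  (C.flatten.flatten ++ (C.flatten.flatten ++ C.flatten.flatten)).foldl (fun p _ => refine C p) []

theorem refine_spec (C : List (List (Steps α))) (p : Steps α) :
    (refine C p = p ∧ ∀ p' ∈ refinements (labelsOf C) (starsOf C) p,
        ¬ (anch p' = true ∧ consistent C p' = true)) ∨
      (refine C p ∈ refinements (labelsOf C) (starsOf C) p ∧ anch (refine C p) = true ∧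
        consistent C (refine C p) = true) := by
  unfold refine
  cases h : (refinements (labelsOf C) (starsOf C) p).filter fun p' =>
      anch p' && consistent C p' with
  | nil => exact .inl ⟨rfl, by simpa using h⟩
  | cons p' l =>
    have := List.mem_filter.1 (h ▸ List.mem_cons_self : p' ∈ _)
    rw [Bool.and_eq_true] at this
    exact .inr this

theorem greedy_spec {C : List (List (Steps α))} (hC : ∀ W ∈ C, W ≠ []) :
    anch (greedy C) = true ∧ consistent C (greedy C) = true := by
  unfold greedy
  refine List.foldlRecOn _ (motive := fun p => anch p = true ∧ consistent C p = true) _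
    ⟨rfl, ?_⟩ fun p hp _ _ => ?_
  · simp only [consistent, List.all_eq_true, List.any_eq_true]
    intro W hW
    obtain ⟨w, hw⟩ := List.exists_mem_of_ne_nil W (hC W hW)
    exact ⟨w, hw, by simp⟩
  · rcases refine_spec C p with ⟨h, -⟩ | ⟨-, h⟩
    · rwa [h]
    · exact h

/-- If there is a least consistent anchored path then it is found. -/
theorem greedy_eq {C : List (List (Steps α))} {q w : Steps α} (hC : ∀ W ∈ C, W ≠ [])
    (hq : anch q = true) (hqC : consistent C q = true)
    (hmin : ∀ p, anch p = true → consistent C p = true → emb p q = true) (hqw : emb q w = true)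
    (hw : w ∈ C.flatten) (hpre : ∀ n, w.take n ∈ C.flatten) : greedy C = q := by
  have hA : ∀ e a, (e, some a) ∈ q → a ∈ labelsOf C := by
    intro e a ha
    obtain ⟨e', h⟩ := emb_mem hqw ha
    exact List.mem_flatMap.2 ⟨(e', some a), List.mem_flatten.2 ⟨w, hw, h⟩, by simp⟩
  have hN : ∀ k ≤ q.length, List.replicate k (.child, none) ∈ starsOf C := by
    intro k hk
    -- The prefix of `w` of length `k` supplies the run of `k` stars.
    refine List.mem_map.2 ⟨w.take k, hpre k, ?_⟩
    rw [List.map_const', List.length_take, min_eq_left (hk.trans (emb_length hqw))]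
  -- As long as the measure is below that of `q`, some consistent refinement exists, because
  -- refinements that map to `q` inherit its consistency. So a round makes progress.
  have hstep : ∀ p, emb p q = true → anch p = true → meas q ≤ meas (refine C p) ∨
      meas p < meas (refine C p) := by
    intro p hp ha
    rcases refine_spec C p with ⟨h, hno⟩ | ⟨h, -⟩
    · left
      rw [h]
      by_contra! hlt
      obtain ⟨p', h₁, h₂, h₃, -⟩ := exists_mem_refinements hp ha hq
        (by rintro rfl; exact lt_irrefl _ hlt) hA hN
      refine hno p' h₁ ⟨h₂, ?_⟩
      simp only [consistent, List.all_eq_true, List.any_eq_true] at hqC ⊢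
      exact fun W hW => (hqC W hW).imp fun v hv => ⟨hv.1, emb_trans h₃ hv.2⟩
    · exact .inr (meas_lt_of_mem_refinements h)
  have key : ∀ l : List (Edge × Option α), ∀ p, anch p = true → consistent C p = true →
      (meas q ≤ meas (l.foldl (fun p _ => refine C p) p) ∨
        meas p + l.length ≤ meas (l.foldl (fun p _ => refine C p) p)) := by
    intro l
    induction l with
    | nil => simp
    | cons x l ih =>
      intro p hp hpC
      rw [List.foldl_cons, List.length_cons]
      have h' : anch (refine C p) = true ∧ consistent C (refine C p) = true := by
        rcases refine_spec C p with ⟨h, -⟩ | ⟨-, h⟩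
        · rw [h]; exact ⟨hp, hpC⟩
        · exact h
      rcases ih _ h'.1 h'.2 with h | h
      · exact .inl h
      · rcases hstep p (hmin p hp hpC) hp with h₁ | h₁ <;> omega
  obtain ⟨h₁, h₂⟩ := greedy_spec hC
  refine (emb_meas (hmin _ h₁ h₂)).2 ?_
  have h₀ : consistent C [] = true := by
    simp only [consistent, List.all_eq_true, List.any_eq_true] at hqC ⊢
    exact fun W hW => (hqC W hW).imp fun v hv => ⟨hv.1, by simp⟩
  rcases key _ [] rfl h₀ with h | h
  · exact h
  · refine le_trans ?_ h
    have := meas_le q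
    have := emb_length hqw
    have := (List.sublist_flatten_of_mem hw).length_le
    simp only [List.length_append]
    omega

/-- The common root label of the trees in a list. -/
def headLabel (S : List (LTree α)) : Option α :=
  match S with
  | [] => none
  | t :: S => bif S.all fun t' => decide (t'.label = t.label) then some t.label else none

theorem headLabel_eq_some {S : List (LTree α)} {a : α} :
    headLabel S = some a ↔ S ≠ [] ∧ ∀ t ∈ S, t.label = a := by
  cases S with
  | nil => simp [headLabel]
  | cons t S =>
    simp only [headLabel, ne_eq, reduceCtorEq, not_false_eq_true, true_and, List.mem_cons,
      forall_eq_or_imp]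
    cases h : S.all fun t' => decide (t'.label = t.label) with
    | false =>
      simp only [List.all_eq_false, decide_eq_true_eq] at h
      obtain ⟨t', ht', hne⟩ := h
      simp only [cond_false, reduceCtorEq, false_iff]
      rintro ⟨rfl, h⟩
      exact hne (h t' ht')
    | true =>
      simp only [List.all_eq_true, decide_eq_true_eq] at h
      simp only [cond_true, Option.some.injEq]
      exact ⟨fun e => ⟨e, e ▸ h⟩, And.left⟩

/-- The paths learned from the sample with the additional requirement to match two of its words. -/
def candidatePaths (S : List (LTree α)) : List (Steps α) :=
  (S.map treeWords).flatten.flatMap fun w =>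
    (S.map treeWords).flatten.map fun w' => greedy ([w] :: [w'] :: S.map treeWords)

/-- The most specific paths in a list. -/
def mostSpecific (R : List (Steps α)) : List (Steps α) :=
  R.filter fun p => R.all fun p' => !emb p p' || emb p' p

theorem mem_mostSpecific {R : List (Steps α)} {p : Steps α} :
    p ∈ mostSpecific R ↔ p ∈ R ∧ ∀ p' ∈ R, emb p p' = true → p' = p := by
  simp only [mostSpecific, List.mem_filter, List.all_eq_true, Bool.or_eq_true,
    Bool.not_eq_true']
  refine and_congr_right fun _ => forall₂_congr fun p' _ => ?_
  constructor
  · rintro (h | h) h'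
    · simp [h'] at h
    · exact emb_antisymm h h'
  · intro h
    cases hp : emb p p' with
    | false => exact .inl rfl
    | true => exact .inr (by rw [h hp]; exact emb_refl _)

theorem mostSpecific_ne_nil {R : List (Steps α)} (hR : R ≠ []) : mostSpecific R ≠ [] := by
  classical
  -- A path of greatest measure is maximal by `emb_meas`.
  obtain ⟨p, hp, hmax⟩ := R.toFinset.exists_max_image meas (by simpa using hR)
  refine List.ne_nil_of_mem (a := p) (mem_mostSpecific.2 ⟨by simpa using hp, fun p' hp' h => ?_⟩)
  exact ((emb_meas h).2 (hmax p' (by simpa using hp'))).symm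

end algorithm

/-! ### Running time of the learning algorithm -/

section sizes

variable {α : Type u}

theorem sz_step_le (s : Edge × Option α) : sz α s ≤ 5 := by
  have := sz_edge_le (α := α) s.1
  simp only [sz_prod, sz_option]; omega

theorem sz_steps_le (p : Steps α) : sz α p ≤ p.length * 6 + 1 :=
  sz_list_le fun s _ => sz_step_le s

theorem LTree.size_le_sz (t : LTree α) : t.size ≤ sz α t := by
  have h : ∀ (l : List (LTree α)), (∀ t ∈ l, t.size ≤ sz α t) →
      (l.map LTree.size).sum ≤ (Enc.enc l : Data α).size := by
    intro l hl
    induction l with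
    | nil => simp
    | cons t l ih =>
      have h₁ := ih fun t ht => hl t (List.mem_cons_of_mem _ ht)
      have h₂ := hl t (by simp)
      have h₃ : (Enc.enc (t :: l) : Data α).size = 1 + sz α t + (Enc.enc l : Data α).size := rfl
      simp only [List.map_cons, List.sum_cons]; omega
  induction t using LTree.induction with
  | h a ts ih =>
    have := h ts ih
    rw [LTree.size, LTree.sizeList_eq]
    have h₂ : sz α (LTree.node a ts) = 1 + 1 + (Enc.enc ts : Data α).size := by
      rw [← LTree.encodeList_eq]; rfl
    omega

end sizes

namespace PT

variable {α : Type u} [LinearOrder α] [OrderBot α] {β γ : Type*} [Enc α β] [Enc α γ]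

theorem treeWords {f : β → LTree α} (hf : PT α f) : PT α fun b => treeWords (f b) := by
  refine PT.comp (g := _root_.treeWords) ?_ hf
  have hstep : PT α (wordStep (α := α)) := by
    refine listCases (l := fun s : List (Steps α × LTree α) × List (Steps α) => s.1) id.fst
      (g := fun s => s)
      (h := fun p => (p.2.1.2.children.map
        (fun t => (p.2.1.1 ++ [(.child, .some t.label)], t)) ++ p.2.2, p.2.1.1 :: p.1.2)) id
      ((append (map (f := fun (p : (List (Steps α × LTree α) × List (Steps α)) ×
          (Steps α × LTree α) × List (Steps α × LTree α)) t =>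
          (p.2.1.1 ++ [(Edge.child, Option.some t.label)], t))
        ((id.fst.snd.fst.fst.append
          ((edgeConst .child).pair id.snd.label.some).singleton).pair id.snd)
          id.snd.fst.snd.children) id.snd.snd).pair (id.snd.fst.fst.cons id.fst.snd)) ?_ ?_
    · rintro ⟨st, out⟩ h
      obtain rfl : st = [] := h
      rfl
    · rintro ⟨st, out⟩ x xs h
      obtain rfl : st = x :: xs := h
      rfl
  -- After `i` rounds all stored words have length at most `i` and at most `i` words have been put
  -- out. Together with `stackSize_iterate` this bounds the state.
  have hinv : ∀ (t : LTree α) (i : ℕ), i ≤ t.size →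
      (∀ x ∈ (wordStep^[i] ([([], t)], [])).1, x.1.length ≤ i) ∧
      (∀ u ∈ (wordStep^[i] ([([], t)], [])).2, u.length ≤ i) ∧
      (wordStep^[i] ([([], t)], [])).2.length ≤ i := by
    intro t i hi
    induction i with
    | zero => simp
    | succ i ih =>
      obtain ⟨h₁, h₂, h₃⟩ := ih (by omega)
      rw [Function.iterate_succ_apply']
      generalize wordStep^[i] ([([], t)], []) = s at *
      obtain ⟨_ | ⟨x, st⟩, out⟩ := s
      · exact ⟨by simp [wordStep], fun u hu => (h₂ u hu).trans (by omega), h₃.trans (by omega)⟩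
      · have hx := h₁ x (by simp)
        refine ⟨?_, ?_, by simpa [wordStep] using h₃⟩
        · simp only [wordStep, List.mem_append, List.mem_map]
          rintro y (⟨t', -, rfl⟩ | hy)
          · simpa using hx
          · exact (h₁ y (by simp [hy])).trans (by omega)
        · simp only [wordStep, List.mem_cons]
          rintro u (rfl | hu)
          · exact hx.trans (by omega)
          · exact (h₂ u hu).trans (by omega)
  have hsz : PolyBdd α fun t : LTree α => t.size := PolyBdd.size.mono fun t => t.size_le_sz
  refine (iterate (α := α) (test := fun s : List (Steps α × LTree α) × List (Steps α) =>
    !s.1.isEmpty) (step := wordStep) (init := fun t => ([([], t)], [])) (n := LTree.size)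
    id.fst.isEmpty.not hstep ((nil.pair id).singleton.pair nil) hsz
    (fun t => 1 + (t.size * (1 + (t.size * 6 + 1) + 4 * t.size + 1) + 1) +
      (t.size * (t.size * 6 + 1 + 1) + 1)) ?_ ?_ ?_ ?_).snd
  · have h6 := (hsz.mul (.const 6)).add (.const 1)
    exact ((PolyBdd.const 1).add ((hsz.mul ((((PolyBdd.const 1).add h6).add
      ((PolyBdd.const 4).mul hsz)).add (.const 1))).add (.const 1))).add
      ((hsz.mul (h6.add (.const 1))).add (.const 1))
  · intro t i hi
    obtain ⟨h₁, h₂, h₃⟩ := hinv t i hi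
    have h₄ := stackSize_iterate t i
    generalize wordStep^[i] ([([], t)], []) = s at *
    obtain ⟨st, out⟩ := s
    simp only at h₁ h₂ h₃ h₄
    have h₅ : st.length ≤ stackSize st := by
      clear h₁ h₄
      induction st with
      | nil => simp
      | cons x st ih =>
        have := x.2.size_eq
        simp only [stackSize, List.map_cons, List.sum_cons, List.length_cons] at *; omega
    have h₆ : ∀ x ∈ st, sz α x ≤ 1 + (t.size * 6 + 1) + 4 * t.size := by
      intro x hx
      have k₁ := h₁ x hx
      have k₂ := sz_steps_le x.1
      have k₃ : x.2.size ≤ stackSize st :=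
        List.single_le_sum (by simp) _ (List.mem_map.2 ⟨x, hx, rfl⟩)
      have k₄ := x.2.sz_add_one_le
      simp only [sz_prod]; omega
    have h₇ : ∀ u ∈ out, sz α u ≤ t.size * 6 + 1 := by
      intro u hu
      have k₁ := h₂ u hu
      have k₂ := sz_steps_le u
      omega
    have h₈ := sz_list_le h₆
    have h₉ := sz_list_le h₇
    have k₁ : st.length * (1 + (t.size * 6 + 1) + 4 * t.size + 1) ≤
      t.size * (1 + (t.size * 6 + 1) + 4 * t.size + 1) := Nat.mul_le_mul_right _ (by omega)
    have k₂ : out.length * (t.size * 6 + 1 + 1) ≤ t.size * (t.size * 6 + 1 + 1) :=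
      Nat.mul_le_mul_right _ (by omega)
    simp only [sz_prod]; omega
  · intro t i hi
    have := stackSize_iterate t i
    have hne : ¬ stackSize (wordStep^[i] ([([], t)], [])).1 = 0 := by omega
    rw [stackSize_eq_zero] at hne
    simpa using hne
  · intro t
    have := stackSize_iterate t t.size
    rw [Nat.sub_self, stackSize_eq_zero] at this
    simp [this]

theorem labLe {f g : β → Option α} (hf : PT α f) (hg : PT α g) :
    PT α fun b => labLe (f b) (g b) := by
  refine optionCases hf (boolConst true)
    (h := fun p => _root_.labLe (Option.some p.2) (g p.1)) ?_ (fun b h => by simp [h])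
    (fun b a h => by simp [h])
  refine optionCases (o := fun p : β × α => g p.1) (hg.comp id.fst) (boolConst false)
    (h := fun p => decide (p.1.2 = p.2)) (eq id.fst.snd id.snd) (fun b h => ?_) (fun b a h => ?_)
  · rw [h]; rfl
  · rw [h]; rfl

theorem emb {f g : β → Steps α} (hf : PT α f) (hg : PT α g) : PT α fun b => emb (f b) (g b) := by
  -- A table entry has size at most `1 + 5 + 3`, and its list cell adds one.
  have hT : ∀ l : List ((Edge × Option α) × Bool), sz α l ≤ l.length * 10 + 1 := fun l =>
    sz_list_le fun s _ => by
      have := sz_step_le s.1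
      have := sz_bool_le (α := α) s.2
      simp only [sz_prod s]; omega
  have hlen : ∀ (y : Edge × Option α) (l : List ((Edge × Option α) × Bool)),
      (embRow y l).2.length = l.length := by
    intro y l
    unfold embRow
    induction l with
    | nil => rfl
    | cons s l ih => simpa using ih
  have hrow : PT α fun p : (Edge × Option α) × List ((Edge × Option α) × Bool) =>
      embRow p.1 p.2 := by
    refine foldr (α := α) (σ := Bool × List ((Edge × Option α) × Bool))
      (f := fun (p : (Edge × Option α) × List ((Edge × Option α) × Bool)) s acc => (s.2, (s.1,
        bif s.1.1.isDesc then _root_.labLe s.1.2 p.1.2 && acc.1 || s.2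
        else !p.1.1.isDesc && (_root_.labLe s.1.2 p.1.2 && acc.1)) :: acc.2)) ?_ id.snd
      ((boolConst true).pair nil) (fun p => 1 + 3 + (sz α p.2 * 10 + 1))
      (((PolyBdd.const (1 + 3)).add ((id.snd.polyBdd.mul (.const 10)).add (.const 1)))) ?_
    · have hl := (labLe (α := α) (f := fun x : ((Edge × Option α) ×
        List ((Edge × Option α) × Bool)) × ((Edge × Option α) × Bool) ×
        (Bool × List ((Edge × Option α) × Bool)) => x.2.1.1.2) (g := fun x => x.1.1.2)
        id.snd.fst.fst.snd id.fst.fst.snd).and id.snd.snd.fst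
      exact id.snd.fst.snd.pair ((id.snd.fst.fst.pair (id.snd.fst.fst.fst.isDesc.cond
        (hl.or id.snd.fst.snd) (id.fst.fst.fst.isDesc.not.and hl))).cons id.snd.snd.snd)
    · rintro ⟨y, row⟩ l h
      have h₁ := hT (embRow y l).2
      rw [hlen] at h₁
      have h₂ := h.length_le
      have h₃ := length_lt_sz (α := α) row
      have h₄ := sz_bool_le (α := α) (embRow y l).1
      change sz α (embRow y l) ≤ _
      simp only [sz_prod (embRow y l)] at *; omega
  have htable : PT α fun b => embTable (f b) (g b) := by
    simp only [embTable_eq_foldr]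
    refine foldr (α := α) (f := fun (_ : β) y row => (embRow y row).2)
      (hrow.comp id.snd).snd hg (map (f := fun _ s => (s, false)) (id.snd.pair (boolConst false)) hf)
      (fun b => sz α (f b) * 10 + 1) ((hf.polyBdd.mul (.const 10)).add (.const 1)) ?_
    intro b l hl
    clear hl
    refine (hT _).trans ?_
    have : (l.foldr (fun y row => (embRow y row).2) ((f b).map fun s => (s, false))).length =
        (f b).length := by
      induction l with
      | nil => simp
      | cons y l ih => simp [hlen, ih]
    rw [this]
    have := length_lt_sz (α := α) (f b)
    omega
  refine listCases htable (boolConst true) (h := fun p => p.2.1.2) id.snd.fst.snd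
    (fun b h => ?_) (fun b s l h => ?_)
  · rw [← tableHead_embTable, h]; rfl
  · rw [← tableHead_embTable, h]; rfl

end PT

-- Sizes of refinements.

section refinementSizes

variable {α : Type u}

theorem length_refinements_le (A : List α) (N : List (Steps α)) (p : Steps α) :
    (refinements A N p).length ≤ (p.length + 1) * (1 + A.length + N.length) := by
  induction p with
  | nil => simp [refinements]; omega
  | cons s p ih =>
    obtain ⟨e, x⟩ := s
    have : (refineFirst A N e x p).length ≤ A.length + N.length := by
      cases x <;> cases e <;> simp [refineFirst, Edge.isDesc]
    simp only [refinements, List.length_append, List.length_map, List.length_cons]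
    rw [add_mul (p.length + 1)]
    omega

/-- A refinement adds at most one star sequence from `N` and a constant. The growth is additive, so
polynomially many rounds keep the path polynomially large. -/
theorem sz_le_of_mem_refinements {A : List α} {N : List (Steps α)} {p r : Steps α}
    (h : r ∈ refinements A N p) : sz α r ≤ sz α p + sz α N + 20 := by
  induction p generalizing r with
  | nil =>
    have := sz_steps_le r
    simp only [refinements, List.mem_cons, List.mem_map] at h
    rcases h with rfl | ⟨a, -, rfl⟩ <;> simp at * <;> omega
  | cons s p ih =>
    obtain ⟨e, x⟩ := s
    simp only [refinements, List.mem_append, List.mem_map] at h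
    rcases h with h | ⟨r, h, rfl⟩
    · cases x with
      | none =>
        simp only [refineFirst, List.mem_map] at h
        obtain ⟨a, -, rfl⟩ := h
        simp; omega
      | some b =>
        cases e with
        | child => simp [refineFirst, Edge.isDesc] at h
        | desc =>
          have h₁ := sz_edge_le (α := α) .desc
          have h₂ := sz_edge_le (α := α) .child
          simp only [refineFirst, Edge.isDesc, cond_true, List.mem_append, List.mem_map] at h
          rcases h with ⟨a, -, rfl⟩ | ⟨n, hn, rfl⟩
          · simp; omega
          · have h₃ := sz_append (α := α) n ((.child, some b) :: p)
            have h₄ := sz_le_of_mem (α := α) hn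
            simp at *; omega
    · have := ih h
      simp only [sz_cons]; omega

end refinementSizes

namespace PT

variable {α : Type u} [LinearOrder α] [OrderBot α] {β γ σ : Type*} [Enc α β] [Enc α γ] [Enc α σ]

/-- Structural recursion on lists. -/
theorem listRec {F : β → List γ → σ} {l : β → List γ} {h : β × γ × List γ × σ → σ} (hl : PT α l)
    (hg : PT α fun b => F b []) (hh : PT α h)
    (hF : ∀ b x xs, F b (x :: xs) = h (b, x, xs, F b xs)) (B : β → ℕ) (hB : PolyBdd α B)
    (hsize : ∀ b l', l' <:+ l b → sz α (F b l') ≤ B b) : PT α fun b => F b (l b) := by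
  -- The fold carries the suffix along with the value, since the recursion step `h` needs both.
  have key : ∀ b (l' : List γ), l'.foldr
      (fun x (acc : List γ × σ) => (x :: acc.1, h (b, x, acc.1, acc.2))) ([], F b []) =
        (l', F b l') := by
    intro b l'
    induction l' with
    | nil => rfl
    | cons x l' ih => rw [List.foldr_cons, ih, hF]
  have := (foldr (α := α)
    (f := fun b x (acc : List γ × σ) => (x :: acc.1, h (b, x, acc.1, acc.2)))
    (init := fun b => ([], F b []))
    ((id.snd.fst.cons id.snd.snd.fst).pair
      (hh.comp (id.fst.pair (id.snd.fst.pair (id.snd.snd.fst.pair id.snd.snd.snd)))))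
    hl (nil.pair hg) (fun b => 1 + sz α (l b) + B b)
    (((PolyBdd.const 1).add hl.polyBdd).add hB) (fun b l' h' => by
      rw [key]
      have h₁ := hsize b l' h'
      obtain ⟨l₂, h'⟩ := h'
      have h₂ := sz_append (α := α) l₂ l'
      have h₃ := sz_pos (α := α) l₂
      rw [h'] at h₂
      simp only [sz_prod]; omega)).snd
  convert this using 2 with b
  rw [key]

theorem anch {f : β → Steps α} (hf : PT α f) : PT α fun b => anch (f b) := by
  have hfirst : PT α fun p : (Edge × Option α) × Steps α =>
      match p.2 with | [] => p.1.1.isDesc | s :: _ => !p.1.1.isDesc && !s.1.isDesc :=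
    listCases (l := fun p : (Edge × Option α) × Steps α => p.2) id.snd id.fst.fst.isDesc
      (h := fun q => !q.1.1.1.isDesc && !q.2.1.1.isDesc)
      (id.fst.fst.fst.isDesc.not.and id.snd.fst.fst.isDesc.not) (fun p h => by rw [h])
      (fun p s l h => by rw [h])
  exact listRec (α := α) (F := fun (_ : β) p => _root_.anch p) hf (boolConst true)
    ((id.snd.fst.snd.isSome.or (hfirst.comp (id.snd.fst.pair id.snd.snd.fst))).and
      id.snd.snd.snd) (fun b x xs => by obtain ⟨e, x⟩ := x; cases xs <;> rfl) (fun _ => 3)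
    (.const 3) (fun b l _ => sz_bool_le _)

theorem refinements {A : β → List α} {N : β → List (Steps α)} {p : β → Steps α} (hA : PT α A)
    (hN : PT α N) (hp : PT α p) : PT α fun b => refinements (A b) (N b) (p b) := by
  have hfirst : PT α fun q : β × (Edge × Option α) × Steps α × List (Steps α) =>
      refineFirst (A q.1) (N q.1) q.2.1.1 q.2.1.2 q.2.2.1 := by
    refine optionCases (o := fun q : β × (Edge × Option α) × Steps α × List (Steps α) => q.2.1.2)
      id.snd.fst.snd
      (g := fun q => (A q.1).map fun a => (q.2.1.1, Option.some a) :: q.2.2.1)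
      (h := fun r => bif r.1.2.1.1.isDesc then
        (A r.1.1).map (fun a => (Edge.desc, Option.some a) :: (Edge.desc, Option.some r.2) ::
          r.1.2.2.1) ++ (N r.1.1).map (fun n => n ++ (Edge.child, Option.some r.2) :: r.1.2.2.1)
        else []) ?_ ?_ (fun q h => by rw [h]; rfl) (fun q a h => by rw [h]; rfl)
    · exact map (f := fun (q : β × (Edge × Option α) × Steps α × List (Steps α)) a =>
        (q.2.1.1, Option.some a) :: q.2.2.1)
        ((id.fst.snd.fst.fst.pair id.snd.some).cons id.fst.snd.snd.fst) (hA.comp id.fst)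
    · refine id.fst.snd.fst.fst.isDesc.cond (append ?_ ?_) nil
      · exact map (f := fun (r : (β × (Edge × Option α) × Steps α × List (Steps α)) × α) a =>
          (Edge.desc, Option.some a) :: (Edge.desc, Option.some r.2) :: r.1.2.2.1)
          (((edgeConst .desc).pair id.snd.some).cons
            (((edgeConst .desc).pair id.fst.snd.some).cons id.fst.fst.snd.snd.fst))
          (hA.comp id.fst.fst)
      · exact map (f := fun (r : (β × (Edge × Option α) × Steps α × List (Steps α)) × α) n =>
          n ++ (Edge.child, Option.some r.2) :: r.1.2.2.1)
          (id.snd.append (((edgeConst .child).pair id.fst.snd.some).cons id.fst.fst.snd.snd.fst))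
          (hN.comp id.fst.fst)
  refine listRec (α := α) (F := fun b p => _root_.refinements (A b) (N b) p) hp
    (((edgeConst .desc).pair none).singleton.cons
      (map (f := fun _ a => [(Edge.desc, Option.some a)])
        ((edgeConst .desc).pair id.snd.some).singleton hA))
    (h := fun q => refineFirst (A q.1) (N q.1) q.2.1.1 q.2.1.2 q.2.2.1 ++
      q.2.2.2.map (q.2.1 :: ·))
    (hfirst.append (map (f := fun (q : β × (Edge × Option α) × Steps α × List (Steps α)) r =>
      q.2.1 :: r) (id.fst.snd.fst.cons id.snd) id.snd.snd.snd)) (fun b x xs => rfl)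
    (fun b => (sz α (p b) + 1) * (1 + sz α (A b) + sz α (N b)) *
      (sz α (p b) + sz α (N b) + 20 + 1) + 1)
    (((((hp.polyBdd.add (.const 1)).mul (((PolyBdd.const 1).add hA.polyBdd).add hN.polyBdd))).mul
      (((hp.polyBdd.add hN.polyBdd).add (.const 20)).add (.const 1))).add (.const 1)) ?_
  intro b l' h'
  have h₀ : sz α l' ≤ sz α (p b) := by
    obtain ⟨l₂, h'⟩ := h'
    have h₂ := sz_append (α := α) l₂ l'
    have h₃ := sz_pos (α := α) l₂
    rw [h'] at h₂
    omega
  have h₁ : ∀ r ∈ _root_.refinements (A b) (N b) l', sz α r ≤ sz α (p b) + sz α (N b) + 20 :=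
    fun r hr => (sz_le_of_mem_refinements hr).trans (by omega)
  refine (sz_list_le h₁).trans (Nat.add_le_add_right (Nat.mul_le_mul_right _ ?_) _)
  refine (length_refinements_le _ _ _).trans (Nat.mul_le_mul ?_ ?_)
  · have := length_lt_sz (α := α) l'
    omega
  · have := length_lt_sz (α := α) (A b)
    have := length_lt_sz (α := α) (N b)
    omega

theorem consistent {C : β → List (List (Steps α))} {p : β → Steps α} (hC : PT α C)
    (hp : PT α p) : PT α fun b => consistent (C b) (p b) :=
  all (f := fun b (W : List (Steps α)) => W.any (_root_.emb (p b)))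
    (any (f := fun (q : β × List (Steps α)) w => _root_.emb (p q.1) w)
      (emb (hp.comp id.fst.fst) id.snd) id.snd) hC

theorem labelsOf {C : β → List (List (Steps α))} (hC : PT α C) : PT α fun b => labelsOf (C b) :=
  flatMap (f := fun _ (s : Edge × Option α) => s.2.toList)
    (optionCases (o := fun q : β × Edge × Option α => q.2.2) id.snd.snd nil
      (h := fun r => [r.2]) id.snd.singleton (fun b h => by rw [h]; rfl)
      (fun b a h => by rw [h]; rfl)) hC.flatten.flatten

theorem starsOf {C : β → List (List (Steps α))} (hC : PT α C) : PT α fun b => starsOf (C b) :=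
  map (f := fun _ (w : Steps α) => w.map fun _ => (Edge.child, (Option.none : Option α)))
    (map (f := fun _ _ => (Edge.child, (Option.none : Option α))) ((edgeConst .child).pair none)
      id.snd) hC.flatten

theorem refineStep {C : β → List (List (Steps α))} {p : β → Steps α} (hC : PT α C)
    (hp : PT α p) : PT α fun b => refine (C b) (p b) :=
  listCases (filter (f := fun b p' => _root_.anch p' && _root_.consistent (C b) p')
    (id.snd.anch.and (consistent (hC.comp id.fst) id.snd)) (refinements hC.labelsOf hC.starsOf hp))
    hp (h := fun q => q.2.1) id.snd.fst (fun b h => by rw [refine, h]; rfl)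
    (fun b x l h => by rw [refine, h]; rfl)

theorem greedy {C : β → List (List (Steps α))} (hC : PT α C) : PT α fun b => greedy (C b) := by
  have hl := hC.flatten.flatten.append (hC.flatten.flatten.append hC.flatten.flatten)
  refine foldl (f := fun b p _ => refine (C b) p) (refineStep (hC.comp id.fst) id.snd.fst) hl nil
    (fun b => 1 + sz α ((C b).flatten.flatten ++
      ((C b).flatten.flatten ++ (C b).flatten.flatten)) * (sz α (_root_.starsOf (C b)) + 20))
    ((PolyBdd.const 1).add (hl.polyBdd.mul (hC.starsOf.polyBdd.add (.const 20)))) ?_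
  intro b l' h'
  have key : ∀ (l : List (Edge × Option α)) (p : Steps α),
      sz α (l.foldl (fun p _ => refine (C b) p) p) ≤
        sz α p + l.length * (sz α (_root_.starsOf (C b)) + 20) := by
    intro l
    induction l with
    | nil => simp
    | cons x l ih =>
      intro p
      have h₁ := ih (refine (C b) p)
      have h₂ : sz α (refine (C b) p) ≤ sz α p + sz α (_root_.starsOf (C b)) + 20 := by
        rcases refine_spec (C b) p with ⟨h, -⟩ | ⟨h, -⟩
        · rw [h]; omega
        · exact sz_le_of_mem_refinements h
      rw [List.foldl_cons, List.length_cons, add_mul]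
      omega
  refine (key l' []).trans (Nat.add_le_add_left (Nat.mul_le_mul_right _ ?_) _)
  exact h'.length_le.trans (length_lt_sz (α := α) _).le

theorem headLabel {S : β → List (LTree α)} (hS : PT α S) : PT α fun b => headLabel (S b) :=
  listCases hS none (h := fun q => bif q.2.2.all fun t => decide (t.label = q.2.1.label) then
      Option.some q.2.1.label else Option.none)
    ((all (f := fun (q : β × LTree α × List (LTree α)) t => decide (t.label = q.2.1.label))
      (id.snd.label.eq id.fst.snd.fst.label) id.snd.snd).cond id.snd.fst.label.some none)
    (fun b h => by rw [h]; rfl) (fun b x l h => by rw [h]; rfl)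

theorem words {S : β → List (LTree α)} (hS : PT α S) :
    PT α fun b => (S b).map _root_.treeWords :=
  map (f := fun _ t => _root_.treeWords t) id.snd.treeWords hS

theorem candidatePaths {S : β → List (LTree α)} (hS : PT α S) :
    PT α fun b => candidatePaths (S b) :=
  flatMap (f := fun b w => ((S b).map _root_.treeWords).flatten.map fun w' =>
      _root_.greedy ([w] :: [w'] :: (S b).map _root_.treeWords))
    (map (f := fun (q : β × Steps α) w' =>
      _root_.greedy ([q.2] :: [w'] :: (S q.1).map _root_.treeWords))
      (id.fst.snd.singleton.cons (id.snd.singleton.cons (hS.comp id.fst.fst).words)).greedy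
      (hS.comp id.fst).words.flatten) hS.words.flatten

theorem mostSpecific {R : β → List (Steps α)} (hR : PT α R) : PT α fun b => mostSpecific (R b) :=
  filter (f := fun b p => (R b).all fun p' => !_root_.emb p p' || _root_.emb p' p)
    (all (f := fun (q : β × Steps α) p' => !_root_.emb q.2 p' || _root_.emb p' q.2)
      ((emb id.fst.snd id.snd).not.or (emb id.snd id.fst.snd)) (hR.comp id.fst)) hR

end PT

/-! ### Characteristic samples -/

section characteristic

variable {α : Type u}

theorem mem_words_flatten {l : List (LTree α)} {u : Steps α} :
    u ∈ (l.map treeWords).flatten ↔ ∃ t ∈ l, ∃ w, IsPath t w ∧ u = wordSteps w := by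
  simp [mem_treeWords]

theorem words_ne_nil (l : List (LTree α)) : ∀ W ∈ l.map treeWords, W ≠ [] := by
  simp only [List.mem_map]
  rintro _ ⟨t, -, rfl⟩
  exact List.ne_nil_of_mem (mem_treeWords.2 ⟨[], by simp [IsPath], rfl⟩)

theorem take_mem_words {l : List (LTree α)} {u : Steps α} (h : u ∈ (l.map treeWords).flatten)
    (n : ℕ) : u.take n ∈ (l.map treeWords).flatten := by
  obtain ⟨t, ht, w, hw, rfl⟩ := mem_words_flatten.1 h
  exact mem_words_flatten.2 ⟨t, ht, w.take n, hw.take n, by simp [wordSteps, List.map_take]⟩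

variable [LinearOrder α]

theorem consistent_words_iff {l : List (LTree α)} {p : Steps α} :
    consistent (l.map treeWords) p = true ↔
      ∀ t ∈ l, ∃ w, IsPath t w ∧ emb p (wordSteps w) = true := by
  simp only [consistent, List.all_map, List.all_eq_true, Function.comp_apply, List.any_eq_true,
    mem_treeWords]
  refine forall₂_congr fun t _ => ⟨?_, ?_⟩
  · rintro ⟨_, ⟨w, hw, rfl⟩, h⟩
    exact ⟨w, hw, h⟩
  · rintro ⟨w, hw, h⟩
    exact ⟨_, ⟨w, hw, rfl⟩, h⟩

theorem emb_wordSteps_of_prefix {v w : List α} (h : v <+: w) {p : Steps α}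
    (hp : emb p (wordSteps v) = true) : emb p (wordSteps w) = true := by
  refine emb_trans hp ?_
  obtain ⟨u, rfl⟩ := h
  clear hp
  induction v with
  | nil => simp
  | cons a v ih => simpa using ih

theorem lang_subset_of_emb {p q : Steps α} (h : emb p q = true) (x : Option α) :
    (PathQuery.mk x q).lang ⊆ (PathQuery.mk x p).lang := by
  intro t ht
  rw [PathQuery.mem_lang_iff] at *
  exact ⟨ht.1, ht.2.imp fun w hw => ⟨hw.1, emb_trans h hw.2⟩⟩

variable [OrderBot α] [Infinite α]

/-- The characteristic sample of the conjunction of the paths in `Ps`, with root label `h`. -/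
theorem exists_characteristic (h : Option α) {Ps : List (Steps α)} (hPs : Ps ≠ []) :
    ∃ CS : Finset (LTree α), CS.Nonempty ∧
      (∀ p ∈ Ps, ∀ t ∈ CS, t ∈ (PathQuery.mk h p).lang) ∧
      ∑ t ∈ CS, t.size ≤
        (1 + (Ps.map List.length).sum) + (1 + (Ps.map List.length).sum) ^ 2 ∧
      ∀ l : List (LTree α), (∀ t ∈ CS, ∃ t' ∈ l, t.Iso t') →
        (∀ p ∈ Ps, ∀ t ∈ l, t ∈ (PathQuery.mk h p).lang) →
        headLabel l = h ∧
        (∀ r, anch r = true → consistent (l.map treeWords) r = true →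
          ∃ p ∈ Ps, emb r p = true) ∧
        ∀ p ∈ Ps, ∃ w₁ ∈ (l.map treeWords).flatten, ∃ w₂ ∈ (l.map treeWords).flatten,
          emb p w₁ = true ∧ emb p w₂ = true ∧
          ∀ r, anch r = true → emb r w₁ = true → emb r w₂ = true → emb r p = true := by
  classical
  set M := (Ps.map List.length).sum with hM
  have hlen : ∀ p ∈ Ps, p.length ≤ M := fun p hp =>
    List.single_le_sum (by simp) _ (List.mem_map.2 ⟨p, hp, rfl⟩)
  -- The label `c` is new to all paths and differs from `⊥`.
  obtain ⟨c, hc⟩ := Infinite.exists_notMem_finset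
    (insert ⊥ (Ps.flatten.flatMap fun s => s.2.toList).toFinset)
  simp only [Finset.mem_insert, List.mem_toFinset, List.mem_flatMap, not_or, not_exists,
    not_and] at hc
  obtain ⟨hc₀, hc⟩ := hc
  have hcP : ∀ p ∈ Ps, ∀ e, (e, some c) ∉ p := fun p hp e he =>
    hc (e, some c) (List.mem_flatten.2 ⟨p, hp, he⟩) (by simp)
  -- The label `d` also fills in for a wildcard at the root. The sample consists of `T 0 ⊥` and `T M
  -- c`.
  let T : ℕ → α → LTree α := fun m d => glue (h.getD d) (Ps.map (canon m d))
  have hT : ∀ m d p, p ∈ Ps → IsPath (T m d) (canon m d p) := fun m d p hp =>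
    (isPath_glue _ _ _).2 (.inr ⟨_, List.mem_map.2 ⟨p, hp, rfl⟩, List.prefix_rfl⟩)
  have hT' : ∀ m d w, IsPath (T m d) w → ∃ p ∈ Ps, w <+: canon m d p := by
    intro m d w hw
    rcases (isPath_glue _ _ _).1 hw with rfl | ⟨v, hv, hw⟩
    · obtain ⟨p, hp⟩ := List.exists_mem_of_ne_nil _ hPs
      exact ⟨p, hp, List.nil_prefix⟩
    · obtain ⟨p, hp, rfl⟩ := List.mem_map.1 hv
      exact ⟨p, hp, hw⟩
  have hTL : ∀ m d p, p ∈ Ps → T m d ∈ (PathQuery.mk h p).lang := by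
    intro m d p hp
    refine (PathQuery.mem_lang_iff _ _).2 ⟨fun a ha => ?_, _, hT m d p hp, emb_canon m d p⟩
    obtain rfl : h = some a := ha
    rfl
  have hsize : ∀ m d, (T m d).size ≤ 1 + M * (m + 1) := by
    intro m d
    rw [size_glue, hM, ← List.sum_map_mul_right, List.map_map]
    exact Nat.add_le_add_left (List.sum_le_sum fun p _ => length_canon_le m d p) 1
  -- The unstretched word bounds the length of `r` by `M` and shows that `c` does not occur in `r`.
  -- These are the hypotheses of `emb_of_emb_canon` for the stretched word, possibly of another path
  -- `p₂`.
  have core : ∀ r p₁ p₂, anch r = true → p₁ ∈ Ps → emb r (wordSteps (canon 0 ⊥ p₁)) = true →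
      emb r (wordSteps (canon M c p₂)) = true → emb r p₂ = true := by
    intro r p₁ p₂ hr hp₁ h₁ h₂
    refine emb_of_emb_canon hr ?_ (fun e he => ?_) h₂
    · have k₁ := emb_length h₁
      have k₂ := length_canon_le 0 (⊥ : α) p₁
      have k₃ := hlen p₁ hp₁
      simp only [wordSteps, List.length_map] at k₁
      omega
    · obtain ⟨e', he'⟩ := emb_mem h₁ he
      obtain ⟨a, ha, hac⟩ := List.mem_map.1 he'
      obtain ⟨-, rfl⟩ : Edge.child = e' ∧ a = c := by simpa using hac
      rcases mem_canon ha with h | ⟨e, h⟩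
      · exact hc₀ h
      · exact hcP p₁ hp₁ e h
  refine ⟨{T 0 ⊥, T M c}, by simp, ?_, ?_, fun l hl hlP => ?_⟩
  · intro p hp t ht
    rcases Finset.mem_insert.1 ht with rfl | ht
    · exact hTL _ _ p hp
    · rw [Finset.mem_singleton.1 ht]
      exact hTL _ _ p hp
  · have h₁ := hsize 0 ⊥
    have h₂ := hsize M c
    have h₃ : ∑ t ∈ ({T 0 ⊥, T M c} : Finset (LTree α)), t.size ≤
        (T 0 ⊥).size + (T M c).size := by
      by_cases he : T 0 ⊥ = T M c
      · rw [he]; simp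
      · rw [Finset.sum_pair he]
    nlinarith
  · obtain ⟨t₁, ht₁, hi₁⟩ := hl (T 0 ⊥) (by simp)
    obtain ⟨t₂, ht₂, hi₂⟩ := hl (T M c) (by simp)
    refine ⟨?_, fun r hr hrC => ?_, fun p hp => ?_⟩
    · cases h with
      | none =>
        cases hh : headLabel l with
        | none => rfl
        | some a =>
          obtain ⟨-, hh⟩ := headLabel_eq_some.1 hh
          -- With a wildcard root the two trees have the root labels `⊥` and `c`, so no label is
          -- common.
          have e₁ := hi₁.label_eq.trans (hh t₁ ht₁)
          have e₂ := hi₂.label_eq.trans (hh t₂ ht₂)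
          exact absurd (e₂.trans e₁.symm) hc₀
      | some a =>
        rw [headLabel_eq_some]
        refine ⟨List.ne_nil_of_mem ht₁, fun t ht => ?_⟩
        obtain ⟨p, hp⟩ := List.exists_mem_of_ne_nil _ hPs
        exact ((PathQuery.mem_lang_iff _ _).1 (hlP p hp t ht)).1 a rfl
    · rw [consistent_words_iff] at hrC
      obtain ⟨w₁, hw₁, he₁⟩ := hrC t₁ ht₁
      obtain ⟨w₂, hw₂, he₂⟩ := hrC t₂ ht₂
      obtain ⟨p₁, hp₁, hpre₁⟩ := hT' _ _ _ (hi₁.symm.isPath hw₁)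
      obtain ⟨p₂, hp₂, hpre₂⟩ := hT' _ _ _ (hi₂.symm.isPath hw₂)
      exact ⟨p₂, hp₂, core r p₁ p₂ hr hp₁ (emb_wordSteps_of_prefix hpre₁ he₁)
        (emb_wordSteps_of_prefix hpre₂ he₂)⟩
    · exact ⟨_, mem_words_flatten.2 ⟨t₁, ht₁, _, hi₁.isPath (hT 0 ⊥ p hp), rfl⟩,
        _, mem_words_flatten.2 ⟨t₂, ht₂, _, hi₂.isPath (hT M c p hp), rfl⟩,
        emb_canon _ _ _, emb_canon _ _ _, fun r hr => core r p p hr hp⟩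

theorem LTree.Iso.refl {α : Type u} (t : LTree α) : t.Iso t :=
  ⟨Equiv.refl _, rfl, fun _ _ => Iff.rfl, fun _ => rfl⟩

/-- Containment of anchored paths is witnessed by homomorphisms. -/
theorem emb_of_lang_subset {x x' : Option α} {p p' : Steps α} (hp' : anch p' = true)
    (h : (PathQuery.mk x p).lang ⊆ (PathQuery.mk x' p').lang) : emb p' p = true := by
  -- The characteristic sample of `p` alone lies in the larger language, so `p'` is consistent with
  -- it and must map to `p`.
  obtain ⟨CS, -, h₁, -, h₂⟩ := exists_characteristic x (List.cons_ne_nil p [])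
  have h₁' : ∀ t ∈ CS, t ∈ (PathQuery.mk x p).lang := h₁ p (by simp)
  obtain ⟨-, h₃, -⟩ := h₂ CS.toList (fun t ht => ⟨t, by simpa using ht, .refl t⟩)
    (by simpa using h₁')
  obtain ⟨q, hq, he⟩ := h₃ p' hp' (consistent_words_iff.2 fun t ht =>
    ((PathQuery.mem_lang_iff _ _).1 (h (h₁' t (by simpa using ht)))).2)
  obtain rfl : q = p := by simpa using hq
  exact he

end characteristic

/-! ### Learnability -/

section learnability

variable {α : Type u}

/-- Learning queries from trees. -/
def treeSetting (α : Type u) (Q : Type u) (lang : Q → Set (LTree α)) (size : Q → ℕ)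
    (rep : Data α → Q → Prop) : LearningSetting α where
  Example := LTree α
  Query := Q
  lang := lang
  exampleSize t := t.size
  querySize := size
  RepresentsExample d t := ∃ t' : LTree α, t.Iso t' ∧ d = t'.encode
  RepresentsQuery := rep

theorem size_branch (p : Steps α) : Twig.sizeList (PathQuery.branch p) = p.length := by
  induction p with
  | nil => rfl
  | cons s p ih =>
    obtain ⟨e, x⟩ := s
    simp [PathQuery.branch, Twig.sizeList, Twig.size, ih, add_comm]

theorem sizeList_append (l l' : List (Edge × Twig α)) :
    Twig.sizeList (l ++ l') = Twig.sizeList l + Twig.sizeList l' := by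
  induction l with
  | nil => simp [Twig.sizeList]
  | cons s l ih =>
    obtain ⟨e, q⟩ := s
    simp [Twig.sizeList, ih, add_assoc]

theorem ConjPath.size_toTwig (P : ConjPath α) :
    P.toTwig.size = 1 + ((P.paths.toList.map PathQuery.steps).map List.length).sum := by
  rw [ConjPath.toTwig, Twig.size]
  congr 1
  induction P.paths.toList with
  | nil => rfl
  | cons p l ih => simp [List.flatMap_cons, sizeList_append, size_branch, ih]

variable [LinearOrder α]

theorem mem_lang_headLabel {l : List (LTree α)} {p : Steps α}
    (hp : consistent (l.map treeWords) p = true) :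
    ∀ t ∈ l, t ∈ (PathQuery.mk (headLabel l) p).lang := fun t ht =>
  (PathQuery.mem_lang_iff _ _).2 ⟨fun _ ha => (headLabel_eq_some.1 ha).2 t ht,
    consistent_words_iff.1 hp t ht⟩

theorem candidatePaths_spec {l : List (LTree α)} {p : Steps α} (hp : p ∈ candidatePaths l) :
    anch p = true ∧ consistent (l.map treeWords) p = true := by
  obtain ⟨w, -, hp⟩ := List.mem_flatMap.1 hp
  obtain ⟨w', -, rfl⟩ := List.mem_map.1 hp
  obtain ⟨h₁, h₂⟩ := greedy_spec (C := [w] :: [w'] :: l.map treeWords) (by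
    simp only [List.mem_cons]
    rintro W (rfl | rfl | hW)
    · simp
    · simp
    · exact words_ne_nil l W hW)
  refine ⟨h₁, ?_⟩
  rw [consistent, List.all_cons, List.all_cons, Bool.and_eq_true, Bool.and_eq_true] at h₂
  exact h₂.2.2

theorem candidatePaths_ne_nil {l : List (LTree α)} (hl : l ≠ []) : candidatePaths l ≠ [] := by
  obtain ⟨t, ht⟩ := List.exists_mem_of_ne_nil l hl
  have h : ([] : Steps α) ∈ (l.map treeWords).flatten :=
    mem_words_flatten.2 ⟨t, ht, [], by simp [IsPath], rfl⟩
  exact List.ne_nil_of_mem (List.mem_flatMap.2 ⟨[], h, List.mem_map.2 ⟨[], h, rfl⟩⟩)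

variable [OrderBot α]

/-- Separates the learning argument from the machine and from representations: it remains to study a
polynomial-time function on lists of trees that are given up to isomorphism. This function always
yields a query. -/
theorem treeSetting_learnable {Q : Type u} {lang : Q → Set (LTree α)} {size : Q → ℕ}
    {rep : Data α → Q → Prop} {γ : Type*} [Enc α γ] {learn : List (LTree α) → γ}
    (hlearn : PT α learn) (poly : Polynomial ℕ)
    (hiso : ∀ q (t t' : LTree α), t.Iso t' → t ∈ lang q → t' ∈ lang q)
    (hsound : ∀ l, l ≠ [] → ∃ q, rep (Enc.enc (learn l)) q ∧ ∀ t ∈ l, t ∈ lang q)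
    (hcomp : ∀ q, ∃ CS : Finset (LTree α), CS.Nonempty ∧ (∀ t ∈ CS, t ∈ lang q) ∧
      ∑ t ∈ CS, t.size ≤ poly.eval (size q) ∧
      ∀ l : List (LTree α), (∀ t ∈ CS, ∃ t' ∈ l, t.Iso t') → (∀ t ∈ l, t ∈ lang q) →
        ∃ q', rep (Enc.enc (learn l)) q' ∧ lang q' = lang q) :
    (treeSetting α Q lang size rep).Learnable := by
  -- The unit, encoded by `nil`, supplies the tag that distinguishes a returned query from Null.
  obtain ⟨c, T, ⟨P, hP⟩, hc⟩ := (PT.unit (α := α) (β := List (LTree α))).pair hlearn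
  have main : ∀ (S : Finset (LTree α)) (R : Option Q → Prop),
      (∀ l : List (LTree α), (∀ t ∈ S, ∃ t' ∈ l, t.Iso t') → (∀ t' ∈ l, ∃ t ∈ S, t.Iso t') →
        ∃ q, rep (Enc.enc (learn l)) q ∧ R (some q)) →
      (treeSetting α Q lang size rep).Returns c S
        -- Trees with `n` nodes in total have an encoding of size at most `4 * n + 1`.
        ((P.comp (.C 4 * .X + .C 1)).eval ((treeSetting α Q lang size rep).sampleSize S)) R := by
    intro S R hR (l : List (LTree α)) hnd hl ds hds
    replace hnd : List.Nodup (α := LTree α) l := hnd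
    replace hl : ∀ t : LTree α, t ∈ l ↔ t ∈ S := hl
    have hds' : ∃ l' : List (LTree α), ds = l'.map LTree.encode ∧
        List.Forall₂ LTree.Iso l l' := by
      clear hnd hl
      induction hds with
      | nil => exact ⟨[], rfl, .nil⟩
      | cons h _ ih =>
        obtain ⟨t', hi, rfl⟩ := h
        obtain ⟨l', rfl, hl'⟩ := ih
        exact ⟨t' :: l', rfl, .cons hi hl'⟩
    obtain ⟨l', rfl, hl'⟩ := hds'
    obtain ⟨q, hq, hRq⟩ := hR l' (fun t ht => by
        obtain ⟨i, hi, rfl⟩ := List.getElem_of_mem ((hl t).2 ht)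
        exact ⟨l'[i]'(hl'.length_eq ▸ hi), List.getElem_mem _, hl'.get hi _⟩) (fun t' ht' => by
        obtain ⟨i, hi, rfl⟩ := List.getElem_of_mem ht'
        have hi' : i < l.length := hl'.length_eq ▸ hi
        exact ⟨l[i], (hl _).1 (List.getElem_mem _), hl'.get hi' _⟩)
    obtain ⟨n, hn, hnT⟩ := hc l'
    refine ⟨_, n, some q, hn, ?_, ⟨_, rfl, hq⟩, hRq⟩
    refine (hnT.trans (hP l')).trans ?_
    rw [Polynomial.eval_comp]
    refine P.eval_mono_nat ?_
    have h₁ : sz α l' ≤ 4 * LTree.sizeList l' + 1 := LTree.sz_list_le l'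
    have h₂ : LTree.sizeList l' = (l.map LTree.size).sum := by
      rw [LTree.sizeList_eq]
      congr 1
      clear hnd hl hq hRq hR hn hnT h₁ hds
      induction hl' with
      | nil => rfl
      | cons h _ ih => simp [h.size_eq, ih]
    have h₃ : (l.map LTree.size).sum = ∑ t ∈ S, t.size := by
      classical
      rw [← List.sum_toFinset _ hnd]
      exact Finset.sum_congr (by ext t; simp [hl]) fun _ _ => rfl
    rw [h₂, h₃] at h₁
    rw [Polynomial.eval_add, Polynomial.eval_mul, Polynomial.eval_C, Polynomial.eval_C,
      Polynomial.eval_X]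
    exact h₁
  refine ⟨c, _, poly, fun S hS => main S _ fun l h₁ h₂ => ?_, fun q => ?_⟩
  · obtain ⟨t₀, ht₀⟩ := hS
    obtain ⟨t', ht', -⟩ := h₁ t₀ ht₀
    obtain ⟨q, hq, hl⟩ := hsound l (List.ne_nil_of_mem ht')
    refine ⟨q, hq, fun t ht => ?_⟩
    obtain ⟨t', ht', hi⟩ := h₁ t ht
    exact hiso q _ _ hi.symm (hl t' ht')
  · obtain ⟨CS, hne, hCS, hsize, h⟩ := hcomp q
    refine ⟨CS, hne, hCS, hsize, fun S hCSS hS => main S _ fun l h₁ h₂ => ?_⟩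
    exact h l (fun t ht => h₁ t (hCSS ht)) fun t' ht' => by
      obtain ⟨t, ht, hi⟩ := h₂ t' ht'
      exact hiso q _ _ hi (hS ht)

variable [Infinite α]

theorem anchPathSetting_learnable : (anchPathSetting α).Learnable := by
  refine treeSetting_learnable (Q := AnchPath α) (lang := fun p => p.1.lang)
    (learn := fun l => (headLabel l, greedy (l.map treeWords)))
    (PT.id.headLabel.pair PT.id.words.greedy) (.X + .X ^ 2)
    (fun q t t' hi ht => hi.mem_lang ht) (fun l hl => ?_) (fun q => ?_)
  · obtain ⟨h₁, h₂⟩ := greedy_spec (words_ne_nil l)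
    exact ⟨⟨⟨headLabel l, greedy (l.map treeWords)⟩, (PathQuery.anchored_iff _ _).2 h₁⟩, rfl,
      mem_lang_headLabel h₂⟩
  · obtain ⟨⟨h, p⟩, hq⟩ := q
    rw [PathQuery.anchored_iff] at hq
    obtain ⟨CS, h₁, h₂, h₃, h₄⟩ := exists_characteristic h (List.cons_ne_nil p [])
    refine ⟨CS, h₁, h₂ p (by simp), ?_, fun l hl hlq => ⟨_, ?_, rfl⟩⟩
    · simpa [PathQuery.toTwig, Twig.size, size_branch] using h₃
    · obtain ⟨h₅, h₆, h₇⟩ := h₄ l hl (by simpa using hlq)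
      obtain ⟨w, hw, -, -, hpw, -, -⟩ := h₇ p (by simp)
      -- For one path, `h₆` says that every consistent anchored path maps to `p`, so the search
      -- needs no extra words.
      have : greedy (l.map treeWords) = p := greedy_eq (words_ne_nil l) hq
        (consistent_words_iff.2 fun t ht => ((PathQuery.mem_lang_iff _ _).1 (hlq t ht)).2)
        (fun r hr hrC => by simpa using h₆ r hr hrC) hpw hw (take_mem_words hw)
      rw [h₅, this]
      rfl

theorem conjPathSetting_learnable : (conjPathSetting α).Learnable := by
  classical
  refine treeSetting_learnable (Q := ConjPath α) (lang := fun P => P.toTwig.lang)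
    (learn := fun l => (mostSpecific (candidatePaths l)).map fun p => (headLabel l, p))
    (PT.map (f := fun l p => (headLabel l, p)) (PT.id.fst.headLabel.pair PT.id.snd)
      PT.id.candidatePaths.mostSpecific) (.X + .X ^ 2)
    (fun q t t' hi ht => hi.mem_lang ht) (fun l hl => ?_) (fun q => ?_)
  · let R := (mostSpecific (candidatePaths l)).map fun p => PathQuery.mk (headLabel l) p
    have hR : ∀ p, p ∈ R ↔ ∃ r ∈ mostSpecific (candidatePaths l),
      PathQuery.mk (headLabel l) r = p := fun p => List.mem_map
    refine ⟨⟨R.toFinset, ?_, ?_, ?_, ?_⟩, ⟨R, by simp, by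
      simp only [R, Enc.enc, List.map_map]; rfl⟩, fun t ht => ?_⟩
    · simpa [R] using mostSpecific_ne_nil (candidatePaths_ne_nil hl)
    · intro p hp
      obtain ⟨r, hr, rfl⟩ := (hR p).1 (by simpa using hp)
      exact (PathQuery.anchored_iff _ _).2 (candidatePaths_spec (mem_mostSpecific.1 hr).1).1
    · intro p hp p' hp' hle
      obtain ⟨r, hr, rfl⟩ := (hR p).1 (by simpa using hp)
      obtain ⟨r', hr', rfl⟩ := (hR p').1 (by simpa using hp')
      rw [mem_mostSpecific] at hr hr'
      -- Containment of the languages gives a homomorphism from `r'` to `r`, and `r'` is most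
      -- specific among the candidates.
      rw [hr'.2 r hr.1 (emb_of_lang_subset (candidatePaths_spec hr'.1).1 hle)]
    · intro p hp p' hp'
      obtain ⟨r, hr, rfl⟩ := (hR p).1 (by simpa using hp)
      obtain ⟨r', hr', rfl⟩ := (hR p').1 (by simpa using hp')
      rfl
    · rw [ConjPath.mem_lang_iff]
      intro p hp
      obtain ⟨r, hr, rfl⟩ := (hR p).1 (by simpa using hp)
      exact mem_lang_headLabel (candidatePaths_spec (mem_mostSpecific.1 hr).1).2 t ht
  · obtain ⟨h, hh⟩ : ∃ h, ∀ p ∈ q.paths, p = ⟨h, p.steps⟩ := by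
      obtain ⟨p₀, hp₀⟩ := q.nonempty
      exact ⟨p₀.head, fun p hp => by rw [q.headConsistent p₀ hp₀ p hp]⟩
    have hmem : ∀ r, r ∈ q.paths.toList.map PathQuery.steps ↔ PathQuery.mk h r ∈ q.paths := by
      intro r
      simp only [List.mem_map, Finset.mem_toList]
      constructor
      · rintro ⟨p, hp, rfl⟩
        rwa [← hh p hp]
      · exact fun hr => ⟨_, hr, rfl⟩
    obtain ⟨CS, h₁, h₂, h₃, h₄⟩ := exists_characteristic h
      (Ps := q.paths.toList.map PathQuery.steps) (by
        simpa using q.nonempty.ne_empty)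
    refine ⟨CS, h₁, fun t ht => ?_, ?_, fun l hl hlq => ⟨q, ?_, rfl⟩⟩
    · rw [ConjPath.mem_lang_iff]
      intro p hp
      have hp' := hp
      rw [hh p hp] at hp' ⊢
      exact h₂ _ ((hmem _).2 hp') t ht
    · simpa [ConjPath.size_toTwig] using h₃
    · have hlq' : ∀ p ∈ q.paths.toList.map PathQuery.steps, ∀ t ∈ l,
          t ∈ (PathQuery.mk h p).lang := fun p hp t ht =>
        (ConjPath.mem_lang_iff _ _).1 (hlq t ht) _ ((hmem p).1 hp)
      obtain ⟨h₅, h₆, h₇⟩ := h₄ l hl hlq'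
      have hanch : ∀ p ∈ q.paths.toList.map PathQuery.steps, anch p = true := fun p hp =>
        (PathQuery.anchored_iff h p).1 (q.anchored _ ((hmem p).1 hp))
      -- With its two canonical words as extra constraints, every consistent anchored path maps to
      -- `p`, so the greedy search for this pair returns `p`.
      have hin : ∀ p ∈ q.paths.toList.map PathQuery.steps, p ∈ candidatePaths l := by
        intro p hp
        obtain ⟨w₁, hw₁, w₂, hw₂, he₁, he₂, hleast⟩ := h₇ p hp
        refine List.mem_flatMap.2 ⟨w₁, hw₁, List.mem_map.2 ⟨w₂, hw₂, ?_⟩⟩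
        have hcons : ∀ r, consistent ([w₁] :: [w₂] :: l.map treeWords) r = true ↔
            emb r w₁ = true ∧ emb r w₂ = true ∧ consistent (l.map treeWords) r = true := by
          intro r
          rw [consistent, List.all_cons, List.all_cons]
          simp [consistent]
        have hsub : ∀ {w}, w ∈ (l.map treeWords).flatten →
            w ∈ ([w₁] :: [w₂] :: l.map treeWords).flatten := by
          intro w hw
          rw [List.flatten_cons, List.flatten_cons]
          exact List.mem_append_right _ (List.mem_append_right _ hw)
        refine greedy_eq ?_ (hanch p hp) ((hcons p).2 ⟨he₁, he₂, consistent_words_iff.2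
          fun t ht => ((PathQuery.mem_lang_iff _ _).1 (hlq' p hp t ht)).2⟩)
          (fun r hr hrC => ?_) he₁ (hsub hw₁) fun n => hsub (take_mem_words hw₁ n)
        · simp only [List.mem_cons]
          rintro W (rfl | rfl | hW)
          · simp
          · simp
          · exact words_ne_nil l W hW
        · obtain ⟨k₁, k₂, -⟩ := (hcons r).1 hrC
          exact hleast r hr k₁ k₂
      -- A reduced conjunction is an antichain for `emb`.
      have hanti : ∀ p ∈ q.paths.toList.map PathQuery.steps,
          ∀ p' ∈ q.paths.toList.map PathQuery.steps, emb p p' = true → p' = p := by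
        intro p hp p' hp' he
        have := q.reduced _ ((hmem p').1 hp') _ ((hmem p).1 hp) (lang_subset_of_emb he h)
        simpa using this
      -- Each candidate maps to a path of `q`, and these are candidates forming an antichain, so
      -- they are exactly the maximal candidates.
      have hres : ∀ r, r ∈ mostSpecific (candidatePaths l) ↔
          r ∈ q.paths.toList.map PathQuery.steps := by
        intro r
        rw [mem_mostSpecific]
        constructor
        · rintro ⟨hr, hmax⟩
          obtain ⟨k₁, k₂⟩ := candidatePaths_spec hr
          obtain ⟨p, hp, he⟩ := h₆ r k₁ k₂
          rwa [← hmax p (hin p hp) he]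
        · refine fun hr => ⟨hin r hr, fun p' hp' he => ?_⟩
          obtain ⟨k₁, k₂⟩ := candidatePaths_spec hp'
          obtain ⟨p, hp, he'⟩ := h₆ p' k₁ k₂
          obtain rfl := hanti r hr p hp (emb_trans he he')
          exact emb_antisymm he' he
      refine ⟨(mostSpecific (candidatePaths l)).map fun p => PathQuery.mk (headLabel l) p,
        fun p => ?_, by simp only [Enc.enc, List.map_map]; rfl⟩
      rw [h₅, List.mem_map]
      constructor
      · rintro ⟨r, hr, rfl⟩
        exact (hmem r).1 ((hres r).1 hr)
      · intro hp
        exact ⟨p.steps, (hres _).2 ((hmem _).2 (by rwa [← hh p hp])), (hh p hp).symm⟩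

end learnability

theorem mainTheorem2 {α : Type u} [LinearOrder α] [OrderBot α] [Infinite α] :
    (conjPathSetting α).Learnable ∧ (anchPathSetting α).Learnable :=
  ⟨conjPathSetting_learnable, anchPathSetting_learnable⟩
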